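/- \textbf{Setting.} Let $\mathcal D$ be a square torus of side $a>0$, $K$ a number of frequency bands, $r\ge 0$, and $(p_C)$ a probability distribution on the set $\mathcal P(K)$ of non-empty subsets of $\{1,\dots,K\}$. A user is a triple $w=(x,y,C)$: receiver $x\in\mathcal D$, transmitter $y\in\mathcal D$, class $C\in\mathcal P(K)$. A configuration is a finite multiset (finite counting measure) of users, ordered by inclusion $\subseteq$ (counted with multiplicity). A rate-of-transmission function is a measurable map $(w,\Psi)\mapsto R(w,\Psi)\in[0,\infty)$. Given a configuration $\Phi_0$, $\lambda>0$, mean file sizes $\mathbf L=(L_C)$ with $L_C>0$, and $R$, the multiclass spatial birth-and-death dynamics $\Phi=\Delta(\Phi_0,\lambda,\mathbf L,R)=(\Phi_t)_{t\ge 0}$ is defined as follows. The users of $\Phi_0$ are present at time $0$. Further users enter at the times of a Poisson rain of intensity $\lambda$ per unit of time and area on $\mathcal D$ (total rate $\lambda a^2$): the transmitter is uniform on $\mathcal D$, the receiver is at distance $r$ from it in an independent uniform direction, and the class is $C$ with probability $p_C$, independently of everything else. Each user of class $C$, initial or arriving, has an independent exponential file of mean $L_C$. A user $w$ entering at time $t_w$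 with a file of size $F_w$ is present at time $t\geq t_w$ if and only if $\int_{t_w}^t R(w,\Phi_s)\,\mathrm ds<F_w$; thus it leaves as soon as its file is transmitted. The dynamics $\Phi'$ \emph{dominates} $\Phi$ if (a) there are realizations of $\Phi$ and $\Phi'$ on a common probability space such that almost surely $\Phi_t\subseteq\Phi'_t$ for all $t\ge 0$, and (b) for any realizations of $\Phi$ and $\Phi'$, possibly on different probability spaces, all $t_1,\dots,t_n\ge 0$ and all measurable non-decreasing $f$ from $n$-tuples of configurations to $[0,\infty]$, $\mathbb E f(\Phi_{t_1},\dots,\Phi_{t_n})\le \mathbb E f(\Phi'_{t_1},\dots,\Phi'_{t_n})$. \textbf{Theorem.} Let $0<\lambda\le\lambda'$, $0<L_C\le L'_C$ for all $C$, and $\Phi_0\subseteq\Phi'_0$. 1. If $R$ and $R'$ are rate-of-transmission functions with $R'(w,\Psi')\le R(w,\Psi)$ for all configurations $\Psi\subseteq\Psi'$ and all users $w\in\Psi$, then $\Delta(\Phi'_0,\lambda',\mathbf L',R')$ dominates $\Delta(\Phi_0,\lambda,\mathbf L,R)$. 2. Let $\ell:[0,\infty)\to[0,\infty)$ be non-increasing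 with $\ell(0)=1$, let $\mathcal N_0>0$, and for $w=(x,y,C)$ let $$R(w,\Psi)=\frac{|C|\,\ell(r)}{\mathcal N_0+\sum_{(x',y',C')\in\Psi\setminus\{w\}}|C\cap C'|\,\ell(\|x-y'\|)},$$ where $\|\cdot\|$ is the Euclidean distance on the torus and $\Psi\setminus\{w\}$ means that one copy of $w$ (if any) is removed. Then $\Delta(\Phi'_0,\lambda',\mathbf L',R)$ dominates $\Delta(\Phi_0,\lambda,\mathbf L,R)$. In particular, increasing only the arrival rate, only the mean file sizes, only the initial configuration (for the rate function of part 2, or any rate function that is non-increasing in the configuration), or replacing only the rate function as in part 1, gives a dominating process. -/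

import Mathlib

open MeasureTheory ProbabilityTheory
open scoped NNReal ENNReal

universe u v

noncomputable section

namespace SBD

/-! ### Space, classes, users and configurations -/

/-- The square torus of side `a`. -/
abbrev Torus (a : ℝ) : Type := AddCircle a × AddCircle a

/-- Euclidean distance on the square torus. -/
def torusDist {a : ℝ} (x y : Torus a) : ℝ≥0 :=
  NNReal.sqrt (‖x.1 - y.1‖₊ ^ 2 + ‖x.2 - y.2‖₊ ^ 2)

/-- Classes of users: non-empty sets of frequency bands among `K` bands. -/
abbrev Cls (K : ℕ) : Type := {C : Finset (Fin K) // C.Nonempty}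

/-- A user: a receiver, its transmitter, and its class. -/
abbrev User (a : ℝ) (K : ℕ) : Type := (Torus a × Torus a) × Cls K

/-- Location of the receiver of a user. -/
def User.rx {a : ℝ} {K : ℕ} (w : User a K) : Torus a := w.1.1

/-- Location of the transmitter of a user. -/
def User.tx {a : ℝ} {K : ℕ} (w : User a K) : Torus a := w.1.2

/-- The set of bands used by a user. -/
def User.bands {a : ℝ} {K : ℕ} (w : User a K) : Finset (Fin K) := w.2.1

/-- Configurations: finite multisets of users, that is, finite counting measures.
Inclusion of configurations is the order `≤` of multisets. -/
abbrev Config (a : ℝ) (K : ℕ) : Type := Multiset (User a K)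

/-- The counting measure of a configuration. -/
def Config.toMeasure {a : ℝ} {K : ℕ} (Ψ : Config a K) : Measure (User a K) :=
  (Ψ.map Measure.dirac).sum

/-- The usual sigma-algebra on counting measures, generated by the counts `Ψ ↦ Ψ(B)`
for measurable sets `B` of users. -/
instance Config.instMeasurableSpace {a : ℝ} {K : ℕ} : MeasurableSpace (Config a K) :=
  MeasurableSpace.comap Config.toMeasure inferInstance

/-! ### The rate of transmission -/

/-- A rate-of-transmission function: the rate at which a user is served in a configuration. -/
abbrev Rate (a : ℝ) (K : ℕ) : Type := User a K → Config a K → ℝ≥0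

open Classical in
/-- The interference seen by the receiver of `w` in the configuration `Ψ`; its own transmitter
(one copy of `w`) does not interfere. -/
def interference {a : ℝ} {K : ℕ} (ell : ℝ≥0 → ℝ≥0) (w : User a K) (Ψ : Config a K) : ℝ≥0 :=
  ((Ψ.erase w).map fun z =>
    ((w.bands ∩ z.bands).card : ℝ≥0) * ell (torusDist w.rx z.tx)).sum

/-- The rate of transmission for the path-loss function `ell`, the receiver-transmitter
distance `r` and the thermal noise `N0`. -/
def pathLossRate {a : ℝ} {K : ℕ} (ell : ℝ≥0 → ℝ≥0) (r N0 : ℝ≥0) : Rate a K :=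
  fun w Ψ => (w.bands.card : ℝ≥0) * ell r / (N0 + interference ell w Ψ)

/-! ### The random input: Poisson rain, dipoles, classes and file sizes -/

/-- Law of a (receiver, transmitter) dipole: the transmitter is uniform on the torus and the
receiver is at distance `r` from it, in an independent uniform direction. -/
def dipoleLaw (a : ℝ) [Fact (0 < a)] (r : ℝ≥0) : Measure (Torus a × Torus a) :=
  (((AddCircle.haarAddCircle (T := a)).prod (AddCircle.haarAddCircle (T := a))).prod
    (cond volume (Set.Ioc 0 (2 * Real.pi)))).map
    fun q : Torus a × ℝ =>
      (q.1 + ((((r : ℝ) * Real.cos q.2 : ℝ) : AddCircle a),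
        (((r : ℝ) * Real.sin q.2 : ℝ) : AddCircle a)), q.1)

/-- Joint law of an arriving user and its file size: independent dipole and class, the class `C`
having probability `p C`; given the class `C` the file size is exponential of mean `L C`. -/
def markLaw {a : ℝ} [Fact (0 < a)] {K : ℕ} (r : ℝ≥0) (p : PMF (Cls K)) (L : Cls K → ℝ) :
    Measure (User a K × ℝ) :=
  ∑ C : Cls K, p C • ((dipoleLaw a r).map fun q => ((q, C) : User a K)).prod
    (expMeasure (1 / L C))

/-- The parameters of the dynamics: the initial configuration `init`, the arrival rate `lam`
(per unit of time and area), the mean file sizes `L` and the rate-of-transmission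
function `R`. -/
structure Params (a : ℝ) (K : ℕ) where
  init : Config a K
  lam : ℝ
  L : Cls K → ℝ
  R : Rate a K

open Classical in
/-- Labels of all users that ever enter: the initial ones, then the arrivals in order. -/
abbrev Label {a : ℝ} {K : ℕ} (Φ₀ : Config a K) : Type := Φ₀.ToType ⊕ ℕ

open Classical in
/-- One outcome of the input: for each arrival, the time elapsed since the preceding arrival, the
arriving user and its file size; for each initial user, its file size. -/
abbrev Input {a : ℝ} {K : ℕ} (Φ₀ : Config a K) : Type :=
  (ℕ → ℝ × User a K × ℝ) × (Φ₀.ToType → ℝ)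

/-- Time at which a user enters (`0` for the initial users). -/
def Input.entry {a : ℝ} {K : ℕ} {Φ₀ : Config a K} (d : Input Φ₀) : Label Φ₀ → ℝ
  | Sum.inl _ => 0
  | Sum.inr n => ∑ k ∈ Finset.range (n + 1), (d.1 k).1

/-- The user with a given label. -/
def Input.user {a : ℝ} {K : ℕ} {Φ₀ : Config a K} (d : Input Φ₀) : Label Φ₀ → User a K
  | Sum.inl i => i.1
  | Sum.inr n => (d.1 n).2.1

/-- The file size of the user with a given label. -/
def Input.file {a : ℝ} {K : ℕ} {Φ₀ : Config a K} (d : Input Φ₀) : Label Φ₀ → ℝ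
  | Sum.inl i => d.2 i
  | Sum.inr n => (d.1 n).2.2

/-- The law of the input: users arrive according to a Poisson rain of intensity `lam` on the torus
(interarrival times are i.i.d. exponential of rate `lam * a ^ 2`), with independent marks, and the
files of the users of class `C` are independent exponential variables of mean `L C`. -/
structure IsInput {a : ℝ} [Fact (0 < a)] {K : ℕ} (r : ℝ≥0) (p : PMF (Cls K)) (Δ : Params a K)
    {Ω : Type u} [MeasurableSpace Ω] (P : Measure Ω) (d : Ω → Input Δ.init) : Prop where
  arrival_law : ∀ n, HasLaw (fun ω => (d ω).1 n)
    ((expMeasure (Δ.lam * a ^ 2)).prod (markLaw r p Δ.L)) P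
  arrival_indep : iIndepFun (fun n ω => (d ω).1 n) P
  init_law : ∀ i, HasLaw (fun ω => (d ω).2 i) (expMeasure (1 / Δ.L i.1.2)) P
  init_indep : iIndepFun (fun i ω => (d ω).2 i) P
  indep : IndepFun (fun ω => (d ω).1) (fun ω => (d ω).2) P

/-! ### The dynamics -/

/-- `x` is the trajectory driven by the input `d`: at each time `t ≥ 0`, the users in `x t`
are those which have entered and have not yet received their whole file, a user being
served at rate `R w (x s)` at time `s`. -/
def IsTrajectory {a : ℝ} {K : ℕ} {Φ₀ : Config a K} (R : Rate a K) (d : Input Φ₀)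
    (x : ℝ → Config a K) : Prop :=
  ∀ t : ℝ, 0 ≤ t → ∃ S : Finset (Label Φ₀),
    (∀ j, j ∈ S ↔ d.entry j ≤ t ∧
      ∫⁻ s in Set.Icc (d.entry j) t, (R (d.user j) (x s) : ℝ≥0∞) < ENNReal.ofReal (d.file j)) ∧
    x t = S.val.map d.user

/-- `X` is a realization, on the probability space `(Ω, P)`, of the spatial birth-and-death
dynamics with parameters `Δ`. -/
def IsRealization {a : ℝ} [Fact (0 < a)] {K : ℕ} (r : ℝ≥0) (p : PMF (Cls K)) (Δ : Params a K)
    {Ω : Type u} [MeasurableSpace Ω] (P : Measure Ω) (X : ℝ → Ω → Config a K) : Prop :=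
  ∃ d : Ω → Input Δ.init, IsInput r p Δ P d ∧
    ∀ᵐ ω ∂P, IsTrajectory Δ.R (d ω) fun t => X t ω

/-! ### Domination -/

/-- Stochastic order of processes, possibly on different spaces: expectations of non-negative
non-decreasing functionals of finitely many time marginals are ordered. -/
def StochLE {a : ℝ} {K : ℕ} {Ω : Type u} [MeasurableSpace Ω] (P : Measure Ω)
    (X : ℝ → Ω → Config a K) {Ω' : Type v} [MeasurableSpace Ω'] (P' : Measure Ω')
    (X' : ℝ → Ω' → Config a K) : Prop :=
  ∀ (n : ℕ) (t : Fin n → ℝ), (∀ i, 0 ≤ t i) →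
    ∀ f : (Fin n → Config a K) → ℝ≥0∞, Measurable f → Monotone f →
      ∫⁻ ω, f (fun i => X (t i) ω) ∂P ≤ ∫⁻ ω, f (fun i => X' (t i) ω) ∂P'

/-- The dynamics with parameters `Δ'` dominates the one with parameters `Δ`: the two can be
realized together so that almost surely the first contains the second at all times, and
any two realizations are stochastically ordered. -/
def Dominates {a : ℝ} [Fact (0 < a)] {K : ℕ} (r : ℝ≥0) (p : PMF (Cls K))
    (Δ' Δ : Params a K) : Prop :=
  (∃ (Ω : Type) (_ : MeasurableSpace Ω) (P : Measure Ω) (X X' : ℝ → Ω → Config a K),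
    IsProbabilityMeasure P ∧ IsRealization r p Δ P X ∧ IsRealization r p Δ' P X' ∧
      ∀ᵐ ω ∂P, ∀ t : ℝ, 0 ≤ t → X t ω ≤ X' t ω) ∧
  ∀ (Ω : Type u) [MeasurableSpace Ω] (P : Measure Ω) [IsProbabilityMeasure P]
    (Ω' : Type v) [MeasurableSpace Ω'] (P' : Measure Ω') [IsProbabilityMeasure P']
    (X : ℝ → Ω → Config a K) (X' : ℝ → Ω' → Config a K),
    IsRealization r p Δ P X → IsRealization r p Δ' P' X' → StochLE P X P' X'

end SBD

end

/-! Both dynamics are built from one source of randomness, so that every user of the smaller system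
also enters the larger one, at the same time and with a file at least as large. The arrivals of the
larger system are thinned, each being kept with probability `lam / lam'`; the kept ones form a
marked Poisson stream of the smaller intensity (`map_thinning`). Multiplying a file of class `C` by
`L C / L' C ≤ 1` changes its mean from `L' C` to `L C`. The initial users of the smaller system are
embedded injectively among those of the larger one.

Once the inputs are matched, the comparison is deterministic (`IsFlow.le`). Suppose that the order
holds before time `t`. A user still present in the smaller system at `t` has been present there ever
since its entry, and during that time its copy was served no faster in the larger system. The copy
has a file no smaller, so it is present too. The sets of present labels are constant just after each
time, so the order persists a little beyond `t`, and continuation reaches all times. The same scheme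
gives uniqueness of trajectories (`IsFlow.eq`). Existence comes from a recursion on successive
events (`isFlow_flow`), whose times do not accumulate because a label causes at most one entry and
one death.

Existence yields the coupling. By uniqueness, any realization is almost surely the trajectory of its
own input, and the recursion shows that this trajectory is a measurable function of the input.
Finite-dimensional laws therefore depend only on the law of the input, so two arbitrary realizations
may be replaced by the coupled ones.

For the path-loss rate, interference grows with the configuration, so the general statement applies
with equal rates once joint measurability of the rate is known. -/

noncomputable section

namespace SBD

/-! ### Deterministic flows of labelled particles -/

section Flow

open Set Filter Topology

variable {ι : Type*} {e : ι → ℝ} {F : ι → ℝ≥0∞} {c : Set ι → ι → ℝ≥0} {A B : ℝ → Set ι}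

/-- `A t` is the set of labels alive at time `t`: the label `j` enters at time `e j`, is served
at rate `c (A s) j` at time `s`, and dies once it has received the amount `F j`. -/
def IsFlow (e : ι → ℝ) (F : ι → ℝ≥0∞) (c : Set ι → ι → ℝ≥0) (A : ℝ → Set ι) : Prop :=
  ∀ t, 0 ≤ t → ∀ j, j ∈ A t ↔ e j ≤ t ∧ ∫⁻ s in Icc (e j) t, (c (A s) j : ℝ≥0∞) < F j

/-- Finitely many labels enter in bounded time, none before time `0`. -/
structure LocallyFiniteEntries (e : ι → ℝ) : Prop where
  nonneg : ∀ j, 0 ≤ e j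
  finite : ∀ t, {j | e j ≤ t}.Finite

theorem IsFlow.mem_of_le (hA : IsFlow e F c A) {s t : ℝ} (hs : 0 ≤ s) (hst : s ≤ t) {j : ι}
    (hj : e j ≤ s) (h : j ∈ A t) : j ∈ A s :=
  (hA s hs j).2 ⟨hj, (lintegral_mono_set (Icc_subset_Icc_right hst)).trans_lt
    ((hA t (hs.trans hst) j).1 h).2⟩

theorem LocallyFiniteEntries.eventually_le (he : LocallyFiniteEntries e) (t : ℝ) :
    ∀ᶠ s in 𝓝[>] t, ∀ j, e j ≤ s → e j ≤ t := by
  have h1 : ∀ᶠ s in 𝓝[>] t, ∀ j ∈ {j | e j ≤ t + 1}, e j ≤ s → e j ≤ t := by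
    rw [eventually_all_finite (he.finite _)]
    intro j _
    by_cases h : e j ≤ t
    · exact Eventually.of_forall fun _ _ => h
    · have : ∀ᶠ s in 𝓝 t, s < e j := eventually_lt_nhds (not_le.1 h)
      filter_upwards [nhdsWithin_le_nhds this] with s hs h'
      exact absurd h' (not_le.2 hs)
  have h2 : ∀ᶠ s in 𝓝[>] t, s < t + 1 := nhdsWithin_le_nhds (eventually_lt_nhds (by linarith))
  filter_upwards [h1, h2] with s hs hs' j hj
  exact hs j (hj.trans hs'.le) hj

/-- A departed label never returns, so each label is eventually present or eventually absent to the
right of `t`. Only finitely many labels matter, hence `A` has a constant value `S` on some interval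
`(t, b)`; it remains to identify `S` with `A t`. -/
theorem IsFlow.eventually_eq (hA : IsFlow e F c A) (he : LocallyFiniteEntries e) {t : ℝ}
    (ht : 0 ≤ t) : ∀ᶠ s in 𝓝[>] t, A s = A t := by
  have hgt : ∀ᶠ s in 𝓝[>] t, t < s := eventually_mem_nhdsWithin
  have hdich : ∀ j, e j ≤ t → (∀ᶠ s in 𝓝[>] t, j ∈ A s) ∨ ∀ᶠ s in 𝓝[>] t, j ∉ A s := by
    intro j hj
    by_cases h : ∃ s, t < s ∧ j ∈ A s
    · obtain ⟨s, hs, hjs⟩ := h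
      left
      filter_upwards [hgt, nhdsWithin_le_nhds (eventually_lt_nhds hs)] with q hq hq'
      exact hA.mem_of_le (ht.trans hq.le) hq'.le (hj.trans hq.le) hjs
    · push Not at h
      right
      filter_upwards [hgt] with q hq using h q hq
  let S : Set ι := {j | e j ≤ t ∧ ∀ᶠ s in 𝓝[>] t, j ∈ A s}
  have hS : ∀ᶠ s in 𝓝[>] t, A s = S := by
    have h1 : ∀ᶠ s in 𝓝[>] t, ∀ j ∈ {j | e j ≤ t}, (j ∈ A s ↔ j ∈ S) := by
      rw [eventually_all_finite (he.finite _)]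
      intro j hj
      rcases hdich j hj with h | h
      · filter_upwards [h] with s hs
        exact ⟨fun _ => ⟨hj, h⟩, fun _ => hs⟩
      · filter_upwards [h] with s hs
        refine ⟨fun h' => absurd h' hs, fun h' => ?_⟩
        obtain ⟨q, hq1, hq2⟩ := (h.and h'.2).exists
        exact absurd hq2 hq1
    filter_upwards [h1, he.eventually_le t, hgt] with s hs hs' hts
    ext j
    refine ⟨fun h => (hs j ?_).1 h, fun h => (hs j h.1).2 h⟩
    exact hs' j ((hA s (ht.trans hts.le) j).1 h).1
  obtain ⟨b, hb, hbS⟩ := (mem_nhdsGT_iff_exists_Ioo_subset).1 hS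
  have hb : t < b := hb
  -- On `(t, b)` the label `j` is served at the constant finite rate `c S j`, so the strict
  -- inequality that keeps it alive at `t` survives for a short time.
  have key : ∀ᶠ s in 𝓝[>] t, ∀ j ∈ {j | e j ≤ t}, j ∈ A t → j ∈ A s := by
    rw [eventually_all_finite (he.finite _)]
    intro j hj
    by_cases hjt : j ∈ A t
    swap
    · exact Eventually.of_forall fun _ h => absurd h hjt
    have hI := ((hA t ht j).1 hjt).2
    have hlim : Tendsto (fun s : ℝ => (∫⁻ s in Icc (e j) t, (c (A s) j : ℝ≥0∞)) +
        c S j * ENNReal.ofReal (s - t)) (𝓝 t)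
        (𝓝 ((∫⁻ s in Icc (e j) t, (c (A s) j : ℝ≥0∞)) + c S j * ENNReal.ofReal (t - t))) := by
      refine Tendsto.add tendsto_const_nhds (ENNReal.Tendsto.const_mul ?_ (Or.inr (by simp)))
      exact (ENNReal.continuous_ofReal.comp (by fun_prop : Continuous fun s : ℝ => s - t)).tendsto t
    simp only [sub_self, ENNReal.ofReal_zero, mul_zero, add_zero] at hlim
    filter_upwards [nhdsWithin_le_nhds (hlim.eventually_lt_const hI), hgt,
      nhdsWithin_le_nhds (eventually_lt_nhds hb)] with s hs hts hsb _
    refine (hA s (ht.trans hts.le) j).2 ⟨le_trans hj hts.le, lt_of_le_of_lt ?_ hs⟩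
    rw [← Icc_union_Ioc_eq_Icc hj hts.le]
    refine (lintegral_union_le _ _ _).trans (add_le_add le_rfl ?_)
    rw [setLIntegral_congr_fun (g := fun _ => (c S j : ℝ≥0∞)) measurableSet_Ioc]
    · simp
    · intro q hq
      have : A q = S := hbS ⟨hq.1, hq.2.trans_lt hsb⟩
      simp only [this]
  filter_upwards [key, he.eventually_le t, hgt] with s h1 h2 hts
  ext j
  refine ⟨fun h => ?_, fun h => h1 j ((hA t ht j).1 h).1 h⟩
  exact hA.mem_of_le ht hts.le (h2 j ((hA s (ht.trans hts.le) j).1 h).1) h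

/-- Real induction: at the infimum of the failure times, `h1` gives `Q` (vacuously so if the infimum
is `0`), and `h2` then moves past it, a contradiction. -/
theorem forall_nonneg_of_continuation {Q : ℝ → Prop}
    (h1 : ∀ t, 0 ≤ t → (∀ s, 0 ≤ s → s < t → Q s) → Q t)
    (h2 : ∀ t, 0 ≤ t → Q t → ∀ᶠ s in 𝓝[>] t, Q s) : ∀ t, 0 ≤ t → Q t := by
  by_contra! hcon
  obtain ⟨t₁, ht₁, hQ₁⟩ := hcon
  let S : Set ℝ := {t | 0 ≤ t ∧ ¬ Q t}
  have hne : S.Nonempty := ⟨t₁, ht₁, hQ₁⟩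
  have hbd : BddBelow S := ⟨0, fun t h => h.1⟩
  have h0 : 0 ≤ sInf S := le_csInf hne fun t h => h.1
  have hbelow : ∀ s, 0 ≤ s → s < sInf S → Q s := fun s hs hs' => by
    by_contra h
    exact absurd (csInf_le hbd (show s ∈ S from ⟨hs, h⟩)) (not_le.2 hs')
  have hQ := h1 _ h0 hbelow
  obtain ⟨b, hb, hbS⟩ := (mem_nhdsGT_iff_exists_Ioo_subset).1 (h2 _ h0 hQ)
  obtain ⟨s, hs, hsb⟩ := exists_lt_of_csInf_lt hne (show sInf S < b from hb)
  rcases (csInf_le hbd hs).eq_or_lt with h | h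
  · exact hs.2 (h ▸ hQ)
  · exact hs.2 (hbS ⟨h, hsb⟩)

/-- Two flows driven by the same data coincide. -/
theorem IsFlow.eq (hA : IsFlow e F c A) (hB : IsFlow e F c B) (he : LocallyFiniteEntries e) :
    ∀ t, 0 ≤ t → A t = B t := by
  refine forall_nonneg_of_continuation (fun t ht h => ?_) fun t ht h => ?_
  · ext j
    rw [hA t ht j, hB t ht j]
    refine and_congr_right fun _ => ?_
    -- Dropping the endpoint leaves the integrals unchanged, so the amount received by time `t` is
    -- determined by the flow strictly before `t`.
    rw [← setLIntegral_congr (Ico_ae_eq_Icc (a := e j) (b := t) (μ := volume)),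
      ← setLIntegral_congr (Ico_ae_eq_Icc (a := e j) (b := t) (μ := volume)),
      setLIntegral_congr_fun measurableSet_Ico]
    intro s hs
    simp only [h s ((he.nonneg j).trans hs.1) hs.2]
  · filter_upwards [hA.eventually_eq he ht, hB.eventually_eq he ht] with s h1 h2
    rw [h1, h2, h]

/-- Comparison of flows: labels of the first flow are matched to labels of the second one, with
the same entry times, larger files and, as long as the flows are ordered, smaller rates. -/
theorem IsFlow.le {κ : Type*} {e' : κ → ℝ} {F' : κ → ℝ≥0∞} {c' : Set κ → κ → ℝ≥0}
    {A' : ℝ → Set κ} (hA : IsFlow e F c A) (hA' : IsFlow e' F' c' A')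
    (he : LocallyFiniteEntries e) (he' : LocallyFiniteEntries e') (J : ι → κ)
    (hJe : ∀ j, e' (J j) = e j) (hJF : ∀ j, F j ≤ F' (J j))
    (hc : ∀ t, 0 ≤ t → MapsTo J (A t) (A' t) → ∀ j ∈ A t, c' (A' t) (J j) ≤ c (A t) j) :
    ∀ t, 0 ≤ t → MapsTo J (A t) (A' t) := by
  refine forall_nonneg_of_continuation (fun t ht h => ?_) fun t ht h => ?_
  · intro j hj
    have hj' := (hA t ht j).1 hj
    refine (hA' t ht _).2 ⟨(hJe j).trans_le hj'.1, lt_of_le_of_lt ?_ (hj'.2.trans_le (hJF j))⟩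
    rw [hJe, ← setLIntegral_congr (Ico_ae_eq_Icc (a := e j) (b := t) (μ := volume)),
      ← setLIntegral_congr (Ico_ae_eq_Icc (a := e j) (b := t) (μ := volume))]
    -- A label alive at `t` was alive at every `s` in `[e j, t)`, which is what allows `hc` to be
    -- used there.
    refine setLIntegral_mono' measurableSet_Ico fun s hs => ?_
    have hs0 := (he.nonneg j).trans hs.1
    exact_mod_cast hc s hs0 (h s hs0 hs.2) j (hA.mem_of_le hs0 hs.2.le hs.1 hj)
  · filter_upwards [hA.eventually_eq he ht, hA'.eventually_eq he' ht] with s h1 h2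
    rw [h1, h2]
    exact h

end Flow

/-! ### Construction of the flow, event by event -/

section Construction

open Set Filter Topology

variable {ι : Type*} (e : ι → ℝ) (F : ι → ℝ≥0∞) (c : Set ι → ι → ℝ≥0)

/-- Labels alive in the state `σ`, which records the time and the amounts already received. -/
def alive (σ : ℝ≥0∞ × (ι → ℝ≥0∞)) : Set ι :=
  {j | ENNReal.ofReal (e j) ≤ σ.1 ∧ σ.2 j < F j}

open Classical in
/-- Time of the next entry after the state `σ`. -/
def nextEntry (σ : ℝ≥0∞ × (ι → ℝ≥0∞)) : ℝ≥0∞ :=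
  ⨅ j, if σ.1 < ENNReal.ofReal (e j) then ENNReal.ofReal (e j) else ⊤

open Classical in
/-- Time of the next death after the state `σ`, in the absence of entries. -/
def nextDeath (σ : ℝ≥0∞ × (ι → ℝ≥0∞)) : ℝ≥0∞ :=
  ⨅ j, if j ∈ alive e F σ then σ.1 + (F j - σ.2 j) / c (alive e F σ) j else ⊤

/-- Time of the next event after the state `σ`. -/
def nextTime (σ : ℝ≥0∞ × (ι → ℝ≥0∞)) : ℝ≥0∞ :=
  min (nextEntry e σ) (nextDeath e F c σ)

open Classical in
/-- Rate at which the label `j` is served from the state `σ` until the next event. -/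
def serviceRate (σ : ℝ≥0∞ × (ι → ℝ≥0∞)) (j : ι) : ℝ≥0∞ :=
  if ENNReal.ofReal (e j) ≤ σ.1 then (c (alive e F σ) j : ℝ≥0∞) else 0

/-- The state at the next event after the state `σ`. -/
def nextState (σ : ℝ≥0∞ × (ι → ℝ≥0∞)) : ℝ≥0∞ × (ι → ℝ≥0∞) :=
  (nextTime e F c σ, fun j => σ.2 j + serviceRate e F c σ j * (nextTime e F c σ - σ.1))

/-- The state at the `m`-th event. -/
def eventState : ℕ → ℝ≥0∞ × (ι → ℝ≥0∞)
  | 0 => (0, 0)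
  | m + 1 => nextState e F c (eventState m)

/-- The labels alive at time `t`. -/
def flow (t : ℝ) : Set ι :=
  {j | ∃ m, (eventState e F c m).1 ≤ ENNReal.ofReal t ∧
    ENNReal.ofReal t < (eventState e F c (m + 1)).1 ∧ j ∈ alive e F (eventState e F c m)}

variable {e F c}

theorem le_nextTime (σ : ℝ≥0∞ × (ι → ℝ≥0∞)) : σ.1 ≤ nextTime e F c σ := by
  refine le_min (le_iInf fun j => ?_) (le_iInf fun j => ?_)
  · split_ifs with h
    · exact h.le
    · exact le_top
  · split_ifs with h
    · exact le_self_add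
    · exact le_top

theorem monotone_eventState_fst : Monotone fun m => (eventState e F c m).1 :=
  monotone_nat_of_le_succ fun _ => le_nextTime _

theorem flow_eq {t : ℝ} {m : ℕ} (h1 : (eventState e F c m).1 ≤ ENNReal.ofReal t)
    (h2 : ENNReal.ofReal t < (eventState e F c (m + 1)).1) :
    flow e F c t = alive e F (eventState e F c m) := by
  ext j
  refine ⟨fun ⟨n, h3, h4, hj⟩ => ?_, fun hj => ⟨m, h1, h2, hj⟩⟩
  have hnm : n = m := by
    rcases lt_trichotomy n m with h | h | h
    · exact absurd (h4.trans_le (monotone_eventState_fst (Nat.succ_le_of_lt h))) (not_lt.2 h1)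
    · exact h
    · exact absurd (h2.trans_le (monotone_eventState_fst (Nat.succ_le_of_lt h))) (not_lt.2 h3)
  exact hnm ▸ hj

theorem exists_eq_iInf_of_finite {f : ι → ℝ≥0∞} (hf : ∀ b < ⊤, {j | f j < b}.Finite)
    (h : ⨅ j, f j < ⊤) : ∃ j, f j = ⨅ j, f j := by
  obtain ⟨b, hb1, hb2⟩ := exists_between h
  obtain ⟨i, hi⟩ := iInf_lt_iff.1 hb1
  obtain ⟨j, hj, hmin⟩ := exists_min_image _ f (hf b hb2) ⟨i, hi⟩
  refine ⟨j, le_antisymm (le_iInf fun k => ?_) (iInf_le _ _)⟩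
  by_cases hk : f k < b
  · exact hmin k hk
  · exact (le_of_lt hj).trans (not_lt.1 hk)

theorem LocallyFiniteEntries.finite_ofReal_le (he : LocallyFiniteEntries e) {b : ℝ≥0∞}
    (hb : b < ⊤) : {j | ENNReal.ofReal (e j) ≤ b}.Finite :=
  (he.finite b.toReal).subset fun _ hj => (ENNReal.ofReal_le_iff_le_toReal hb.ne).1 hj

/-- Only finitely many labels compete for the next entry before a given time or for the next death,
so a finite infimum is attained. Each event thus makes progress that can be counted. -/
theorem LocallyFiniteEntries.nextTime_lt_top (he : LocallyFiniteEntries e)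
    {σ : ℝ≥0∞ × (ι → ℝ≥0∞)} (h : nextTime e F c σ < ⊤) :
    ∃ j, (σ.1 < ENNReal.ofReal (e j) ∧ nextTime e F c σ = ENNReal.ofReal (e j)) ∨
      (j ∈ alive e F σ ∧ F j ≤ (nextState e F c σ).2 j) := by
  have hσ : σ.1 < ⊤ := (le_nextTime σ).trans_lt h
  classical
  rcases min_choice (nextEntry e σ) (nextDeath e F c σ) with hm | hm
  · have hm' : nextTime e F c σ = nextEntry e σ := hm
    have hfin : ∀ b < ⊤, {j | (if σ.1 < ENNReal.ofReal (e j) then ENNReal.ofReal (e j) else ⊤) <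
        b}.Finite := by
      refine fun b hb => (he.finite_ofReal_le hb).subset fun j hj => ?_
      rw [mem_ofPred_eq] at hj ⊢
      split_ifs at hj with h'
      · exact hj.le
      · exact absurd hj (not_lt.2 le_top)
    have hlt := h
    rw [hm', nextEntry] at hlt
    obtain ⟨j, hj⟩ := exists_eq_iInf_of_finite (by convert hfin) hlt
    refine ⟨j, Or.inl ?_⟩
    change _ = nextEntry e σ at hj
    rw [← hm'] at hj
    split_ifs at hj with h'
    · exact ⟨h', hj.symm⟩
    · exact absurd hj h.ne'
  · have hm' : nextTime e F c σ = nextDeath e F c σ := hm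
    have hfin : ∀ b < ⊤, {j | (if j ∈ alive e F σ then
        σ.1 + (F j - σ.2 j) / c (alive e F σ) j else ⊤) < b}.Finite := by
      refine fun b hb => (he.finite_ofReal_le hσ).subset fun j hj => ?_
      rw [mem_ofPred_eq] at hj ⊢
      split_ifs at hj with h'
      · exact h'.1
      · exact absurd hj (not_lt.2 le_top)
    have hlt := h
    rw [hm', nextDeath] at hlt
    obtain ⟨j, hj⟩ := exists_eq_iInf_of_finite (by convert hfin) hlt
    refine ⟨j, Or.inr ?_⟩
    change _ = nextDeath e F c σ at hj
    rw [← hm'] at hj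
    split_ifs at hj with h'
    · refine ⟨h', ?_⟩
      have hpos : F j - σ.2 j ≠ 0 := (tsub_pos_of_lt h'.2).ne'
      -- With a zero rate the quotient would be `⊤`: an unserved label has no finite death time.
      have hc : (c (alive e F σ) j : ℝ≥0∞) ≠ 0 := by
        intro h0
        rw [h0, ENNReal.div_zero hpos, add_top] at hj
        exact h.ne hj.symm
      simp only [nextState, serviceRate, if_pos h'.1]
      rw [← hj, ENNReal.add_sub_cancel_left hσ.ne, ENNReal.mul_div_cancel hc ENNReal.coe_ne_top,
        add_tsub_cancel_of_le h'.2.le]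
    · exact absurd hj h.ne'

/-- If all event times stayed below `t`, the sets `D m` of recorded entries and completions would
increase strictly forever, although they are all subsets of one finite set. -/
theorem LocallyFiniteEntries.exists_lt_eventState (he : LocallyFiniteEntries e) (t : ℝ) :
    ∃ m, ENNReal.ofReal t < (eventState e F c m).1 := by
  by_contra! hle
  let D : ℕ → Set (ι ⊕ ι) := fun m =>
    Sum.inl '' {j | ENNReal.ofReal (e j) ≤ (eventState e F c m).1} ∪
    Sum.inr '' {j | ENNReal.ofReal (e j) ≤ (eventState e F c m).1 ∧
      F j ≤ (eventState e F c m).2 j}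
  have hstep : ∀ m, D m < D (m + 1) := by
    intro m
    have hT : (eventState e F c m).1 ≤ (eventState e F c (m + 1)).1 := le_nextTime _
    refine ⟨?_, fun hsub => ?_⟩
    · refine union_subset_union (image_mono fun j hj => le_trans hj hT)
        (image_mono fun j hj => ⟨hj.1.trans hT, hj.2.trans ?_⟩)
      exact le_self_add
    · obtain ⟨j, hj | hj⟩ := he.nextTime_lt_top (F := F) (c := c) (σ := eventState e F c m)
        ((hle (m + 1)).trans_lt ENNReal.ofReal_lt_top)
      · have h1 : Sum.inl j ∈ D (m + 1) := Or.inl ⟨j, hj.2.ge, rfl⟩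
        have h2 := hsub h1
        simp only [D, mem_union, mem_image, mem_ofPred_eq, Sum.inl.injEq, exists_eq_right,
          reduceCtorEq, and_false, exists_false, or_false] at h2
        exact absurd h2 (not_le.2 hj.1)
      · have h1 : Sum.inr j ∈ D (m + 1) := Or.inr ⟨j, ⟨hj.1.1.trans hT, hj.2⟩, rfl⟩
        have h2 := hsub h1
        simp only [D, mem_union, mem_image, mem_ofPred_eq, Sum.inr.injEq, exists_eq_right,
          reduceCtorEq, and_false, exists_false, false_or] at h2
        exact absurd h2.2 (not_le.2 hj.1.2)
  have hinj : Function.Injective D := (strictMono_nat_of_lt_succ hstep).injective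
  have hfin := he.finite_ofReal_le (b := ENNReal.ofReal t) ENNReal.ofReal_lt_top
  refine Set.infinite_of_injective_forall_mem hinj
    (s := {S | S ⊆ Sum.inl '' {j | ENNReal.ofReal (e j) ≤ ENNReal.ofReal t} ∪
      Sum.inr '' {j | ENNReal.ofReal (e j) ≤ ENNReal.ofReal t}}) (fun m => ?_)
    ((hfin.image _).union (hfin.image _)).finite_subsets
  exact union_subset_union (image_mono fun j hj => le_trans hj (hle m))
    (image_mono fun j hj => hj.1.trans (hle m))

theorem LocallyFiniteEntries.exists_eventState (he : LocallyFiniteEntries e) (t : ℝ) :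
    ∃ m, (eventState e F c m).1 ≤ ENNReal.ofReal t ∧
      ENNReal.ofReal t < (eventState e F c (m + 1)).1 := by
  classical
  have h := he.exists_lt_eventState (F := F) (c := c) t
  have h0 : Nat.find h ≠ 0 := by
    intro h0
    have := Nat.find_spec h
    rw [h0] at this
    exact absurd this (by simp [eventState])
  obtain ⟨m, hm⟩ := Nat.exists_eq_succ_of_ne_zero h0
  exact ⟨m, not_lt.1 (Nat.find_min h (by omega)), by
    have := Nat.find_spec h
    rwa [hm] at this⟩

-- Between events the flow and the rates are constant, so the amounts in the state are the integrals
-- of the service. The bound on `t` by the next event time is not strict, so that the recursive call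
-- can be made at the event time itself; the half-open interval ignores the value there.
open Classical in
theorem lintegral_flow (he : LocallyFiniteEntries e) (j : ι) (m : ℕ) :
    ∀ t : ℝ, 0 ≤ t → (eventState e F c m).1 ≤ ENNReal.ofReal t →
      ENNReal.ofReal t ≤ (eventState e F c (m + 1)).1 →
      ∫⁻ s in Ico 0 t, (if e j ≤ s then (c (flow e F c s) j : ℝ≥0∞) else 0) =
        (eventState e F c m).2 j + serviceRate e F c (eventState e F c m) j *
          (ENNReal.ofReal t - (eventState e F c m).1) := by
  intro t ht h1 h2
  set σ := eventState e F c m with hσ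
  have hTtop : σ.1 < ⊤ := h1.trans_lt ENNReal.ofReal_lt_top
  set q := σ.1.toReal with hq
  have hq0 : 0 ≤ q := ENNReal.toReal_nonneg
  have hqσ : ENNReal.ofReal q = σ.1 := ENNReal.ofReal_toReal hTtop.ne
  have hqt : q ≤ t := ENNReal.toReal_le_of_le_ofReal ht h1
  have hstart : ∫⁻ s in Ico 0 q, (if e j ≤ s then (c (flow e F c s) j : ℝ≥0∞) else 0) = σ.2 j := by
    cases m with
    | zero =>
      have : q = 0 := by simp [hq, hσ, eventState]
      rw [this, hσ]
      simp [eventState]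
    | succ n =>
      have := lintegral_flow he j n q hq0 (hqσ ▸ monotone_eventState_fst (Nat.le_succ n)) hqσ.le
      rw [this, hqσ]
      rfl
  have hpiece : ∫⁻ s in Ico q t, (if e j ≤ s then (c (flow e F c s) j : ℝ≥0∞) else 0) =
      serviceRate e F c σ j * (ENNReal.ofReal t - σ.1) := by
    rw [setLIntegral_congr_fun (g := fun _ => serviceRate e F c σ j) measurableSet_Ico]
    · rw [setLIntegral_const, Real.volume_Ico, ENNReal.ofReal_sub _ hq0, hqσ]
    · intro s hs
      have hs1 : σ.1 ≤ ENNReal.ofReal s := hqσ ▸ ENNReal.ofReal_le_ofReal hs.1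
      have hs2 : ENNReal.ofReal s < nextTime e F c σ :=
        ((ENNReal.ofReal_lt_ofReal_iff_of_nonneg (hq0.trans hs.1)).2 hs.2).trans_le h2
      simp only [flow_eq (m := m) hs1 hs2, serviceRate]
      refine if_congr ⟨fun h => ?_, fun h => ?_⟩ rfl rfl
      · by_contra hcon
        have h3 : nextTime e F c σ ≤ ENNReal.ofReal (e j) :=
          (min_le_left _ _).trans (iInf_le_of_le j (by rw [if_pos (not_le.1 hcon)]))
        exact absurd (hs2.trans_le h3) (not_lt.2 (ENNReal.ofReal_le_ofReal h))
      · exact (ENNReal.ofReal_le_ofReal_iff (hq0.trans hs.1)).1 (h.trans hs1)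
  rw [← Ico_union_Ico_eq_Ico hq0 hqt, lintegral_union measurableSet_Ico
    (Ico_disjoint_Ico_same), hstart, hpiece]

/-- Presence at `t` can be tested at the last event before it: a label with service left at that
event cannot exhaust its file by `t`, since `t` precedes the next death. Nothing is required of `c`.
-/
theorem isFlow_flow (he : LocallyFiniteEntries e) : IsFlow e F c (flow e F c) := by
  classical
  intro t ht j
  obtain ⟨m, h1, h2⟩ := he.exists_eventState (F := F) (c := c) t
  have hint := lintegral_flow he j m t ht h1 h2.le
  set σ := eventState e F c m with hσ
  have h2' : ENNReal.ofReal t < nextTime e F c σ := h2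
  have hentry : e j ≤ t ↔ ENNReal.ofReal (e j) ≤ σ.1 := by
    refine ⟨fun h => ?_, fun h => (ENNReal.ofReal_le_ofReal_iff ht).1 (h.trans h1)⟩
    by_contra hcon
    have h3 : nextTime e F c σ ≤ ENNReal.ofReal (e j) :=
      (min_le_left _ _).trans (iInf_le_of_le j (by rw [if_pos (not_le.1 hcon)]))
    exact absurd (h2'.trans_le h3) (not_lt.2 (ENNReal.ofReal_le_ofReal h))
  have hsplit : e j ≤ t → ∫⁻ s in Icc (e j) t, (c (flow e F c s) j : ℝ≥0∞) =
      σ.2 j + serviceRate e F c σ j * (ENNReal.ofReal t - σ.1) := by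
    intro hj
    rw [← hint, ← Ico_union_Ico_eq_Ico (he.nonneg j) hj, lintegral_union measurableSet_Ico
      (Ico_disjoint_Ico_same), ← setLIntegral_congr (Ico_ae_eq_Icc (a := e j) (b := t))]
    rw [setLIntegral_congr_fun (g := fun _ => (0 : ℝ≥0∞)) (s := Ico 0 (e j)) measurableSet_Ico
      (fun s hs => if_neg (not_le.2 hs.2)), lintegral_zero, zero_add]
    exact setLIntegral_congr_fun measurableSet_Ico (fun s hs => (if_pos hs.1).symm)
  rw [flow_eq h1 h2, hentry]
  refine and_congr_right fun hj => ?_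
  rw [hsplit (hentry.2 hj)]
  refine ⟨fun h => ?_, fun h => le_self_add.trans_lt h⟩
  have h3 : nextTime e F c σ ≤ σ.1 + (F j - σ.2 j) / c (alive e F σ) j :=
    (min_le_right _ _).trans (iInf_le_of_le j (by rw [if_pos (show j ∈ alive e F σ from ⟨hj, h⟩)]))
  have h4 : ENNReal.ofReal t - σ.1 < (F j - σ.2 j) / c (alive e F σ) j := by
    refine ENNReal.sub_lt_of_lt_add h1 ?_
    rw [add_comm]
    exact h2'.trans_le h3
  have h5 : (c (alive e F σ) j : ℝ≥0∞) * (ENNReal.ofReal t - σ.1) < F j - σ.2 j := by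
    rw [mul_comm]
    exact ENNReal.mul_lt_of_lt_div h4
  rw [serviceRate, if_pos (show ENNReal.ofReal (e j) ≤ σ.1 from hj)]
  exact lt_tsub_iff_left.1 h5

end Construction

/-! ### The trajectory driven by an input -/

section Path

open Set Filter Topology

variable {a : ℝ} {K : ℕ} {Φ₀ Φ₀' : Config a K}

open Classical in
/-- The configuration of the users with labels in the finite set `S`. -/
def Input.config (d : Input Φ₀) (S : Set (Label Φ₀)) : Config a K :=
  if h : S.Finite then h.toFinset.val.map d.user else 0

/-- The rate at which the user with label `j` is served when the labels in `S` are present. -/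
def Input.rate (R : Rate a K) (d : Input Φ₀) (S : Set (Label Φ₀)) (j : Label Φ₀) : ℝ≥0 :=
  R (d.user j) (d.config S)

/-- Labels of the users present at time `t`. -/
def Input.present (R : Rate a K) (d : Input Φ₀) : ℝ → Set (Label Φ₀) :=
  flow d.entry (fun j => ENNReal.ofReal (d.file j)) (d.rate R)

/-- The trajectory driven by the input `d`. -/
def Input.path (R : Rate a K) (d : Input Φ₀) (t : ℝ) : Config a K :=
  d.config (d.present R t)

/-- Interarrival times are nonnegative and the arrival times tend to infinity. -/
structure Input.NonExplosive (d : Input Φ₀) : Prop where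
  nonneg : ∀ k, 0 ≤ (d.1 k).1
  tendsto : Tendsto (fun n => ∑ k ∈ Finset.range n, (d.1 k).1) atTop atTop

theorem Input.config_coe (d : Input Φ₀) (S : Finset (Label Φ₀)) :
    d.config (S : Set (Label Φ₀)) = S.val.map d.user := by
  rw [Input.config, dif_pos S.finite_toSet, Finset.finite_toSet_toFinset]

theorem Input.config_of_not_finite (d : Input Φ₀) {S : Set (Label Φ₀)} (h : ¬ S.Finite) :
    d.config S = 0 :=
  dif_neg h

theorem Input.NonExplosive.locallyFiniteEntries {d : Input Φ₀} (hd : d.NonExplosive) :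
    LocallyFiniteEntries d.entry where
  nonneg j := by
    cases j with
    | inl i => exact le_rfl
    | inr n => exact Finset.sum_nonneg fun k _ => hd.nonneg k
  finite t := by
    obtain ⟨N, hN⟩ := eventually_atTop.1 (hd.tendsto.eventually_gt_atTop t)
    refine ((finite_range Sum.inl).union ((finite_lt_nat N).image Sum.inr)).subset ?_
    rintro (i | n) hj
    · exact Or.inl ⟨i, rfl⟩
    · refine Or.inr ⟨n, ?_, rfl⟩
      by_contra hn
      exact absurd (hN (n + 1) (by have : N ≤ n := not_lt.1 hn; omega)) (not_lt.2 hj)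

theorem Input.NonExplosive.isFlow_present {d : Input Φ₀} (hd : d.NonExplosive) (R : Rate a K) :
    IsFlow d.entry (fun j => ENNReal.ofReal (d.file j)) (d.rate R) (d.present R) :=
  isFlow_flow hd.locallyFiniteEntries

theorem IsFlow.finite {ι : Type*} {e : ι → ℝ} {F : ι → ℝ≥0∞} {c : Set ι → ι → ℝ≥0}
    {A : ℝ → Set ι} (hA : IsFlow e F c A) (he : LocallyFiniteEntries e) {t : ℝ} (ht : 0 ≤ t) :
    (A t).Finite :=
  (he.finite t).subset fun j hj => ((hA t ht j).1 hj).1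

theorem Input.NonExplosive.isTrajectory_path {d : Input Φ₀} (hd : d.NonExplosive) (R : Rate a K) :
    IsTrajectory R d (d.path R) := by
  intro t ht
  have hfl := hd.isFlow_present R
  have hfin := hfl.finite hd.locallyFiniteEntries ht
  refine ⟨hfin.toFinset, fun j => ?_, dif_pos hfin⟩
  rw [Finite.mem_toFinset]
  exact hfl t ht j

/-- The finite label sets that witness the trajectory form a flow, to which uniqueness applies.
Hence every realization is determined by its input. -/
theorem IsTrajectory.eq_path {d : Input Φ₀} (hd : d.NonExplosive) {R : Rate a K}
    {x : ℝ → Config a K} (hx : IsTrajectory R d x) {t : ℝ} (ht : 0 ≤ t) : x t = d.path R t := by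
  have he := hd.locallyFiniteEntries
  choose S hS hxS using hx
  let A : ℝ → Set (Label Φ₀) := fun s => if h : 0 ≤ s then S s h else ∅
  have hxA : ∀ s, 0 ≤ s → x s = d.config (A s) := by
    intro s hs
    simp only [A, dif_pos hs, d.config_coe]
    exact hxS s hs
  have hA : IsFlow d.entry (fun j => ENNReal.ofReal (d.file j)) (d.rate R) A := by
    intro s hs j
    simp only [A, dif_pos hs, Finset.mem_coe, hS]
    refine and_congr_right fun _ => ?_
    rw [setLIntegral_congr_fun measurableSet_Icc]
    intro q hq
    have hq0 : 0 ≤ q := (he.nonneg j).trans hq.1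
    simp only [Input.rate, hxA q hq0, A, dif_pos hq0]
  rw [hxA t ht, hA.eq (hd.isFlow_present R) he t ht]
  rfl

/-- Inclusion counts multiplicity, so the matching of labels has to be injective. -/
theorem Input.config_le_config {d : Input Φ₀} {d' : Input Φ₀'} {J : Label Φ₀ → Label Φ₀'}
    (hJ : Function.Injective J) (hu : ∀ j, d'.user (J j) = d.user j) {S : Set (Label Φ₀)}
    {S' : Set (Label Φ₀')} (hS : S.Finite) (hS' : S'.Finite) (h : MapsTo J S S') :
    d.config S ≤ d'.config S' := by
  lift S to Finset (Label Φ₀) using hS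
  lift S' to Finset (Label Φ₀') using hS'
  rw [d.config_coe, d'.config_coe]
  have h1 : S.val.map d.user = (S.map ⟨J, hJ⟩).val.map d'.user := by
    rw [Finset.map_val, Multiset.map_map]
    exact Multiset.map_congr rfl fun j _ => (hu j).symm
  rw [h1]
  refine Multiset.map_le_map (Finset.val_le_iff.2 fun j hj => ?_)
  obtain ⟨i, hi, rfl⟩ := Finset.mem_map.1 hj
  exact h hi

/-- The comparison of flows asks for ordered rates only while the flows are ordered and only at
labels alive in the smaller one. Then the configurations are ordered and the user lies in the
smaller, exactly the situation covered by `hR`. -/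
theorem Input.path_le_path {d : Input Φ₀} {d' : Input Φ₀'} (hd : d.NonExplosive)
    (hd' : d'.NonExplosive) {R R' : Rate a K}
    (hR : ∀ Ψ Ψ' : Config a K, Ψ ≤ Ψ' → ∀ w ∈ Ψ, R' w Ψ' ≤ R w Ψ) {J : Label Φ₀ → Label Φ₀'}
    (hJ : Function.Injective J) (he : ∀ j, d'.entry (J j) = d.entry j)
    (hu : ∀ j, d'.user (J j) = d.user j)
    (hf : ∀ j, ENNReal.ofReal (d.file j) ≤ ENNReal.ofReal (d'.file (J j))) {t : ℝ} (ht : 0 ≤ t) : d.path R t ≤ d'.path R' t := by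
  have hfl := hd.isFlow_present R
  have hfl' := hd'.isFlow_present R'
  have hloc := hd.locallyFiniteEntries
  have hloc' := hd'.locallyFiniteEntries
  refine config_le_config hJ hu (hfl.finite hloc ht) (hfl'.finite hloc' ht)
    (hfl.le hfl' hloc hloc' J he hf ?_ t ht)
  intro s hs hm j hj
  rw [Input.rate, Input.rate, hu]
  refine hR _ _ (config_le_config hJ hu (hfl.finite hloc hs) (hfl'.finite hloc' hs) hm) _ ?_
  rw [Input.config, dif_pos (hfl.finite hloc hs)]
  exact Multiset.mem_map_of_mem _ ((Finite.mem_toFinset _).2 hj)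

end Path

/-! ### Measurability of the trajectory as a function of the input -/

section PathMeasurable

open Set

variable {a : ℝ} {K : ℕ} {Φ₀ : Config a K}

theorem Config.toMeasure_apply (Ψ : Config a K) {s : Set (User a K)} (hs : MeasurableSet s) :
    Ψ.toMeasure s = (Ψ.map (s.indicator 1)).sum := by
  induction Ψ using Multiset.induction_on with
  | empty => simp [Config.toMeasure]
  | cons w Ψ ih =>
    simp only [Config.toMeasure, Multiset.map_cons, Multiset.sum_cons] at ih ⊢
    rw [Measure.add_apply, ih, Measure.dirac_apply' _ hs]

theorem measurable_config_iff {α : Type*} [MeasurableSpace α] {f : α → Config a K} :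
    Measurable f ↔ ∀ s : Set (User a K), MeasurableSet s →
      Measurable fun x => (f x).toMeasure s := by
  refine ⟨fun h s hs => ?_, fun h => ?_⟩
  · exact (Measure.measurable_coe hs).comp ((comap_measurable Config.toMeasure).comp h)
  · exact measurable_comap_iff.2 (Measure.measurable_of_measurable_coe _ h)

theorem measurable_map_config {α ι : Type*} [MeasurableSpace α] (S : Finset ι)
    {f : ι → α → User a K} (hf : ∀ j, Measurable (f j)) :
    Measurable fun x => (S.val.map fun j => f j x : Config a K) := by
  refine measurable_config_iff.2 fun s hs => ?_
  simp only [Config.toMeasure_apply _ hs, Multiset.map_map, Function.comp_def]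
  exact Finset.measurable_sum S fun j _ => (measurable_one.indicator hs).comp (hf j)

/-- A countable set has countably many finite subsets, so the space is cut into countably many
measurable pieces `{A x = S}` carrying `φ S`, and a remainder where the value is `b`. -/
theorem measurable_of_finite_sets {α β ι : Type*} [MeasurableSpace α] [MeasurableSpace β]
    [Countable ι] {A : α → Set ι} (hA : ∀ j, MeasurableSet {x | j ∈ A x}) {φ : Set ι → α → β}
    {b : β} (hφ : ∀ S : Finset ι, Measurable (φ S)) (hb : ∀ S : Set ι, ¬ S.Finite → ∀ x, φ S x = b) :
    Measurable fun x => φ (A x) x := by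
  have hS : ∀ S : Finset ι, MeasurableSet {x | A x = S} := by
    intro S
    have : {x | A x = S} = ⋂ j, {x | j ∈ A x ↔ j ∈ S} := by
      ext x
      simp [Set.ext_iff]
    rw [this]
    refine MeasurableSet.iInter fun j => ?_
    by_cases hj : j ∈ S
    · simpa [hj] using hA j
    · simp only [hj, iff_false]
      exact (hA j).compl
  intro B hB
  have : (fun x => φ (A x) x) ⁻¹' B = (⋃ S : Finset ι, {x | A x = S} ∩ φ S ⁻¹' B) ∪
      ((⋃ S : Finset ι, {x | A x = S})ᶜ ∩ (fun _ => b) ⁻¹' B) := by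
    ext x
    by_cases h : (A x).Finite
    · lift A x to Finset ι using h with S hS
      simp [← hS]
    · have h' : ∀ S : Finset ι, A x ≠ S := fun S hS => h (hS ▸ S.finite_toSet)
      simp [h', hb _ h]
  rw [this]
  exact (MeasurableSet.iUnion fun S => (hS S).inter (hφ S hB)).union
    ((MeasurableSet.iUnion hS).compl.inter (measurable_const hB))

theorem measurable_entry (j : Label Φ₀) : Measurable fun d : Input Φ₀ => d.entry j := by
  cases j with
  | inl i => exact measurable_const
  | inr n => simp only [Input.entry]; fun_prop

theorem measurable_user (j : Label Φ₀) : Measurable fun d : Input Φ₀ => d.user j := by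
  cases j with
  | inl i => exact measurable_const
  | inr n => simp only [Input.user]; fun_prop

theorem measurable_file (j : Label Φ₀) : Measurable fun d : Input Φ₀ => d.file j := by
  cases j with
  | inl i => simp only [Input.file]; fun_prop
  | inr n => simp only [Input.file]; fun_prop

theorem measurable_inputConfig {A : Input Φ₀ → Set (Label Φ₀)}
    (hA : ∀ j, MeasurableSet {d | j ∈ A d}) : Measurable fun d : Input Φ₀ => d.config (A d) :=
  measurable_of_finite_sets (φ := fun S d => d.config S) hA
    (fun S => by
      simp only [Input.config_coe]
      exact measurable_map_config S measurable_user)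
    (fun _ hS d => d.config_of_not_finite hS)

theorem measurable_rate {R : Rate a K} (hR : Measurable (Function.uncurry R))
    {A : Input Φ₀ → Set (Label Φ₀)} (hA : ∀ j, MeasurableSet {d | j ∈ A d}) (j : Label Φ₀) :
    Measurable fun d : Input Φ₀ => d.rate R (A d) j :=
  hR.comp ((measurable_user j).prodMk (measurable_inputConfig hA))

theorem measurableSet_alive {σ : Input Φ₀ → ℝ≥0∞ × (Label Φ₀ → ℝ≥0∞)} (hσ : Measurable σ)
    (j : Label Φ₀) : MeasurableSet {d : Input Φ₀ |
      j ∈ alive d.entry (fun j => ENNReal.ofReal (d.file j)) (σ d)} := by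
  have h1 := measurable_entry j
  have h2 := measurable_file j
  refine (measurableSet_le (f := fun d : Input Φ₀ => ENNReal.ofReal (d.entry j))
    (g := fun d => (σ d).1) (by fun_prop) (by fun_prop)).inter
    (measurableSet_lt (f := fun d => (σ d).2 j)
    (g := fun d : Input Φ₀ => ENNReal.ofReal (d.file j)) (by fun_prop) (by fun_prop))

theorem measurable_nextState {R : Rate a K} (hR : Measurable (Function.uncurry R))
    {σ : Input Φ₀ → ℝ≥0∞ × (Label Φ₀ → ℝ≥0∞)} (hσ : Measurable σ) :
    Measurable fun d : Input Φ₀ =>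
      nextState d.entry (fun j => ENNReal.ofReal (d.file j)) (d.rate R) (σ d) := by
  classical
  have he := fun j : Label Φ₀ => (measurable_entry j).ennreal_ofReal
  have hf := fun j : Label Φ₀ => (measurable_file j).ennreal_ofReal
  have hal := fun j => measurableSet_alive hσ j
  have hrate := fun j => (measurable_rate hR hal j).coe_nnreal_ennreal
  have hσ1 : Measurable fun d => (σ d).1 := hσ.fst
  have hσ2 : ∀ j, Measurable fun d => (σ d).2 j := fun j => (measurable_pi_apply j).comp hσ.snd
  have hT : Measurable fun d : Input Φ₀ =>
      nextTime d.entry (fun j => ENNReal.ofReal (d.file j)) (d.rate R) (σ d) := by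
    refine Measurable.min (Measurable.iInf fun j => ?_) (Measurable.iInf fun j => ?_)
    · exact Measurable.ite (measurableSet_lt hσ1 (he j)) (he j) measurable_const
    · exact Measurable.ite (hal j) (hσ1.add (((hf j).sub (hσ2 j)).div (hrate j))) measurable_const
  refine hT.prodMk (measurable_pi_lambda _ fun j => ?_)
  refine (hσ2 j).add (Measurable.mul ?_ (hT.sub hσ1))
  exact Measurable.ite (measurableSet_le (he j) hσ1) (hrate j) measurable_const

theorem measurable_eventState {R : Rate a K} (hR : Measurable (Function.uncurry R)) (m : ℕ) :
    Measurable fun d : Input Φ₀ =>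
      eventState d.entry (fun j => ENNReal.ofReal (d.file j)) (d.rate R) m := by
  induction m with
  | zero => exact measurable_const
  | succ m ih => exact measurable_nextState hR ih

/-- Each event state is obtained by countably many measurable operations, and presence at time `t`
is a countable union over the index of the last event. -/
theorem measurable_path {R : Rate a K} (hR : Measurable (Function.uncurry R)) (t : ℝ) :
    Measurable fun d : Input Φ₀ => d.path R t := by
  refine measurable_inputConfig fun j => ?_
  have hst := measurable_eventState (Φ₀ := Φ₀) hR
  have hset : {d : Input Φ₀ | j ∈ d.present R t} = ⋃ m,
      {d | (eventState d.entry (fun j => ENNReal.ofReal (d.file j)) (d.rate R) m).1 ≤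
        ENNReal.ofReal t} ∩ ({d | ENNReal.ofReal t <
        (eventState d.entry (fun j => ENNReal.ofReal (d.file j)) (d.rate R) (m + 1)).1} ∩
      {d | j ∈ alive d.entry (fun j => ENNReal.ofReal (d.file j))
        (eventState d.entry (fun j => ENNReal.ofReal (d.file j)) (d.rate R) m)}) := by
    ext d
    simp only [Input.present, flow, mem_iUnion]
    rfl
  rw [hset]
  refine MeasurableSet.iUnion fun m => ?_
  exact (measurableSet_le (hst m).fst measurable_const).inter
    ((measurableSet_lt measurable_const (hst (m + 1)).fst).inter (measurableSet_alive (hst m) j))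

end PathMeasurable

/-! ### Exponential distributions -/

section Exponential

open Set

theorem expMeasure_Ioi {r : ℝ} (hr : 0 < r) (x : ℝ) :
    expMeasure r (Ioi x) = if 0 ≤ x then ENNReal.ofReal (Real.exp (-(r * x))) else 1 := by
  have := isProbabilityMeasure_expMeasure hr
  have h1 : (expMeasure r (Ioi x)).toReal = 1 - cdf (expMeasure r) x := by
    rw [cdf_eq_real, ← compl_Iic, prob_compl_eq_one_sub measurableSet_Iic, measureReal_def,
      ENNReal.toReal_sub_of_le prob_le_one ENNReal.one_ne_top, ENNReal.toReal_one]
  rw [← ENNReal.ofReal_toReal (measure_ne_top (expMeasure r) (Ioi x)), h1, cdf_expMeasure_eq hr]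
  split_ifs <;> simp

theorem ext_of_Ioi {μ ν : Measure ℝ} [IsProbabilityMeasure μ] [IsProbabilityMeasure ν]
    (h : ∀ x, μ (Ioi x) = ν (Ioi x)) : μ = ν := by
  refine Measure.ext_of_Iic μ ν fun x => ?_
  rw [← compl_Ioi, prob_compl_eq_one_sub measurableSet_Ioi, prob_compl_eq_one_sub measurableSet_Ioi,
    h]

theorem expMeasure_map_mul {r k : ℝ} (hr : 0 < r) (hk : 0 < k) :
    (expMeasure r).map (fun x => x * k) = expMeasure (r / k) := by
  have := isProbabilityMeasure_expMeasure hr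
  have := isProbabilityMeasure_expMeasure (div_pos hr hk)
  have hm : Measurable fun x : ℝ => x * k := by fun_prop
  have := Measure.isProbabilityMeasure_map (μ := expMeasure r) hm.aemeasurable
  refine ext_of_Ioi fun x => ?_
  have hpre : (fun x : ℝ => x * k) ⁻¹' Ioi x = Ioi (x / k) := by
    ext y
    simp [div_lt_iff₀ hk]
  rw [Measure.map_apply hm measurableSet_Ioi, hpre, expMeasure_Ioi hr,
    expMeasure_Ioi (div_pos hr hk)]
  have : 0 ≤ x / k ↔ 0 ≤ x := by
    rw [le_div_iff₀ hk, zero_mul]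
  simp only [this]
  congr 4
  ring

theorem ae_nonneg_expMeasure (r : ℝ) : ∀ᵐ x ∂expMeasure r, 0 ≤ x := by
  have hset : {x : ℝ | ¬ 0 ≤ x} = Iio 0 := by
    ext
    simp
  rw [ae_iff, hset, ← lintegral_exponentialPDF_of_nonpos (r := r) le_rfl]
  exact withDensity_apply _ measurableSet_Iio

theorem lintegral_expMeasure (r : ℝ) {f : ℝ → ℝ≥0∞} (hf : Measurable f) {s : Set ℝ}
    (hs : MeasurableSet s) :
    ∫⁻ x in s, f x ∂expMeasure r = ∫⁻ x in s, exponentialPDF r x * f x := by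
  have hm : Measurable (exponentialPDF r) := (measurable_exponentialPDFReal r).ennreal_ofReal
  exact setLIntegral_withDensity_eq_setLIntegral_mul _ hm hf hs

/-- An exponential time of rate `l` is an exponential time of rate `l' ≥ l` followed, with
probability `1 - l / l'`, by an independent exponential time of rate `l`. -/
theorem expMeasure_eq_add {l l' : ℝ} (hl : 0 < l) (hll : l ≤ l') :
    expMeasure l = ENNReal.ofReal (l / l') • expMeasure l' + ENNReal.ofReal (1 - l / l') •
      ((expMeasure l').prod (expMeasure l)).map fun p => p.1 + p.2 := by
  have hl' : 0 < l' := hl.trans_le hll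
  have hq0 : 0 ≤ l / l' := by positivity
  have hq1 : l / l' ≤ 1 := (div_le_one hl').2 hll
  rcases hll.eq_or_lt with rfl | hlt
  · simp [div_self hl.ne']
  have := isProbabilityMeasure_expMeasure hl
  have := isProbabilityMeasure_expMeasure hl'
  have hadd : Measurable fun p : ℝ × ℝ => p.1 + p.2 := by fun_prop
  have hprob := Measure.isProbabilityMeasure_map (μ := (expMeasure l').prod (expMeasure l))
    hadd.aemeasurable
  have hsum : ENNReal.ofReal (l / l') + ENNReal.ofReal (1 - l / l') = 1 := by
    rw [← ENNReal.ofReal_add hq0 (sub_nonneg.2 hq1)]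
    simp
  have : IsProbabilityMeasure (ENNReal.ofReal (l / l') • expMeasure l' +
      ENNReal.ofReal (1 - l / l') •
      ((expMeasure l').prod (expMeasure l)).map fun p => p.1 + p.2) := by
    constructor
    simp [hsum]
  refine ext_of_Ioi fun x => ?_
  -- Split according to whether the first time already exceeds `x`; if it does, the sum exceeds `x`
  -- almost surely.
  have hconv : (((expMeasure l').prod (expMeasure l)).map fun p => p.1 + p.2) (Ioi x) =
      (∫⁻ s in Iic x, expMeasure l (Ioi (x - s)) ∂expMeasure l') + expMeasure l' (Ioi x) := by
    rw [Measure.map_apply hadd measurableSet_Ioi,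
      Measure.prod_apply (hadd measurableSet_Ioi)]
    have hpre : ∀ s : ℝ, Prod.mk s ⁻¹' ((fun p : ℝ × ℝ => p.1 + p.2) ⁻¹' Ioi x) = Ioi (x - s) := by
      intro s
      ext y
      simp [sub_lt_iff_lt_add']
    simp only [hpre]
    rw [← lintegral_add_compl _ measurableSet_Iic (A := Iic x)]
    congr 1
    rw [compl_Iic, setLIntegral_congr_fun (g := fun _ => 1) measurableSet_Ioi, setLIntegral_one]
    intro s hs
    simp only
    rw [expMeasure_Ioi hl, if_neg (by linarith [show x < s from hs])]
  rw [Measure.add_apply, Measure.smul_apply, Measure.smul_apply, hconv, smul_eq_mul, smul_eq_mul,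
    mul_add, add_left_comm, ← add_mul, hsum, one_mul]
  by_cases hx : 0 ≤ x
  swap
  · have hIic : expMeasure l' (Iic x) = 0 := by
      rw [← compl_Ioi, prob_compl_eq_zero_iff measurableSet_Ioi, expMeasure_Ioi hl', if_neg hx]
    rw [setLIntegral_measure_zero _ _ hIic, mul_zero, zero_add, expMeasure_Ioi hl,
      expMeasure_Ioi hl', if_neg hx, if_neg hx]
  have hd : 0 < l' - l := sub_pos.2 hlt
  have hg : Measurable fun s => expMeasure l (Ioi (x - s)) := by
    simp only [expMeasure_Ioi hl]
    refine Measurable.ite ?_ (by fun_prop) measurable_const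
    exact measurableSet_le measurable_const (by fun_prop)
  -- The product of the density of rate `l'` at `s` with the survival function of rate `l` at `x -
  -- s` is, after the factor `1 - l / l'`, equal to `exp (-l x)` times the density of rate `l' - l`,
  -- whose distribution function is known.
  have hI : ENNReal.ofReal (1 - l / l') * ∫⁻ s in Iic x, expMeasure l (Ioi (x - s)) ∂expMeasure l' =
      ENNReal.ofReal (Real.exp (-(l * x))) * ENNReal.ofReal (1 - Real.exp (-((l' - l) * x))) := by
    have hanti := lintegral_exponentialPDF_eq_antiDeriv hd x
    rw [if_pos hx] at hanti
    have hm : Measurable (exponentialPDF (l' - l)) :=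
      (measurable_exponentialPDFReal _).ennreal_ofReal
    have hm' : Measurable (exponentialPDF l') := (measurable_exponentialPDFReal _).ennreal_ofReal
    rw [lintegral_expMeasure _ hg measurableSet_Iic, ← hanti, ← lintegral_const_mul _ hm,
      ← lintegral_const_mul _ (f := fun s => exponentialPDF l' s * expMeasure l (Ioi (x - s)))
        (hm'.mul hg)]
    refine setLIntegral_congr_fun measurableSet_Iic fun s hs => ?_
    have hs : s ≤ x := hs
    by_cases hs0 : 0 ≤ s
    · simp only [expMeasure_Ioi hl, if_pos (sub_nonneg.2 hs), exponentialPDF_of_nonneg hs0]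
      rw [← ENNReal.ofReal_mul (by positivity), ← ENNReal.ofReal_mul (by linarith),
        ← ENNReal.ofReal_mul (by positivity)]
      congr 1
      have e1 : Real.exp (-(l' * s)) * Real.exp (-(l * (x - s))) =
          Real.exp (-(l * x)) * Real.exp (-((l' - l) * s)) := by
        rw [← Real.exp_add, ← Real.exp_add]
        congr 1
        ring
      have e2 : (1 - l / l') * l' = l' - l := by
        field_simp
      calc (1 - l / l') * (l' * Real.exp (-(l' * s)) * Real.exp (-(l * (x - s))))
          = ((1 - l / l') * l') * (Real.exp (-(l' * s)) * Real.exp (-(l * (x - s)))) := by ring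
        _ = _ := by rw [e1, e2]; ring
    · simp only [exponentialPDF_of_neg (not_le.1 hs0), zero_mul, mul_zero]
  rw [hI, expMeasure_Ioi hl, expMeasure_Ioi hl', if_pos hx, if_pos hx,
    ← ENNReal.ofReal_mul (by positivity), ← ENNReal.ofReal_add _ (by positivity)]
  · congr 1
    have e3 : Real.exp (-(l * x)) * Real.exp (-((l' - l) * x)) = Real.exp (-(l' * x)) := by
      rw [← Real.exp_add]
      congr 1
      ring
    rw [mul_sub, e3]
    ring
  · refine mul_nonneg (by positivity) (sub_nonneg.2 (Real.exp_le_one_iff.2 ?_))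
    have : 0 ≤ (l' - l) * x := by positivity
    linarith

end Exponential

/-! ### Sequences of independent, identically distributed variables -/

section Sequences

open Set Filter Topology

variable {E : Type*} [MeasurableSpace E]

/-- A box over a finite set of indices becomes a box over an initial segment when padded with
`univ`. -/
theorem eq_infinitePi_nat {μ : ℕ → Measure E} [∀ i, IsProbabilityMeasure (μ i)]
    {ν : Measure (ℕ → E)} (h : ∀ (n : ℕ) (t : ℕ → Set E), (∀ i, MeasurableSet (t i)) →
      ν {ω | ∀ i < n, ω i ∈ t i} = ∏ i ∈ Finset.range n, μ i (t i)) :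
    ν = Measure.infinitePi μ := by
  classical
  refine Measure.eq_infinitePi _ fun s t ht => ?_
  obtain ⟨n, hn⟩ := s.exists_nat_subset_range
  have h1 := h n (fun i => if i ∈ s then t i else univ) fun i => by
    split_ifs
    · exact ht i
    · exact MeasurableSet.univ
  have h2 : {ω : ℕ → E | ∀ i < n, ω i ∈ (if i ∈ s then t i else univ)} = Set.pi s t := by
    ext ω
    simp only [mem_ofPred_eq, Set.mem_pi, Finset.mem_coe]
    refine ⟨fun hω i hi => by simpa [hi] using hω i (Finset.mem_range.1 (hn hi)), fun hω i _ => ?_⟩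
    split_ifs with hi
    · exact hω i hi
    · trivial
  rw [h2] at h1
  rw [h1, ← Finset.prod_subset hn]
  · exact Finset.prod_congr rfl fun i hi => by rw [if_pos hi]
  · intro i _ hi
    rw [if_neg hi, measure_univ]

/-- If a space splits as an independent block and a copy of itself, then the successive blocks
are independent and identically distributed. -/
theorem map_iterate_eq_infinitePi {Ω : Type*} [MeasurableSpace Ω] {P : Measure Ω}
    [IsProbabilityMeasure P] {ν : Measure E} [IsProbabilityMeasure ν] {f : Ω → E} {g : Ω → Ω}
    (hf : Measurable f) (hg : Measurable g) (h : P.map (fun ω => (f ω, g ω)) = ν.prod P) :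
    P.map (fun ω n => f (g^[n] ω)) = Measure.infinitePi fun _ : ℕ => ν := by
  have hfg : ∀ n, Measurable fun ω => f (g^[n] ω) := fun n => hf.comp (hg.iterate n)
  refine eq_infinitePi_nat fun n => ?_
  have hset : ∀ (n : ℕ) (t : ℕ → Set E), (∀ i, MeasurableSet (t i)) →
      MeasurableSet {ω | ∀ i < n, f (g^[i] ω) ∈ t i} := fun n t ht => by
    have : {ω | ∀ i < n, f (g^[i] ω) ∈ t i} = ⋂ i, ⋂ (_ : i < n), (fun ω => f (g^[i] ω)) ⁻¹' t i := by
      ext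
      simp
    rw [this]
    exact MeasurableSet.iInter fun i => MeasurableSet.iInter fun _ => hfg i (ht i)
  suffices hs : ∀ (t : ℕ → Set E), (∀ i, MeasurableSet (t i)) →
      P {ω | ∀ i < n, f (g^[i] ω) ∈ t i} = ∏ i ∈ Finset.range n, ν (t i) by
    intro t ht
    rw [Measure.map_apply (measurable_pi_lambda _ hfg), ← hs t ht]
    · rfl
    · have : {ω : ℕ → E | ∀ i < n, ω i ∈ t i} = ⋂ i, ⋂ (_ : i < n), (fun ω => ω i) ⁻¹' t i := by
        ext
        simp
      rw [this]
      exact MeasurableSet.iInter fun i => MeasurableSet.iInter fun _ => measurable_pi_apply i (ht i)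
  induction n with
  | zero => simp
  | succ n ih =>
    intro t ht
    have hsplit : {ω | ∀ i < n + 1, f (g^[i] ω) ∈ t i} = (fun ω => (f ω, g ω)) ⁻¹'
        (t 0 ×ˢ {ω | ∀ i < n, f (g^[i] ω) ∈ t (i + 1)}) := by
      ext ω
      simp only [mem_ofPred_eq, mem_preimage, mem_prod]
      rw [← Function.iterate_zero_apply g ω]
      refine ⟨fun hω => ⟨hω 0 (by omega), fun i hi => hω (i + 1) (by omega)⟩, ?_⟩
      rintro ⟨h0, hω⟩ (_ | i) hi
      · exact h0
      · exact hω i (by omega)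
    rw [hsplit, ← Measure.map_apply (hf.prodMk hg) ((ht 0).prod (hset n _ fun i => ht (i + 1))), h,
      Measure.prod_prod, ih _ fun i => ht (i + 1), Finset.prod_range_succ', mul_comm]

/-- The sequence with first term `p.1` followed by the sequence `p.2`. -/
def consSeq (p : E × (ℕ → E)) : ℕ → E
  | 0 => p.1
  | n + 1 => p.2 n

theorem measurable_consSeq : Measurable (consSeq (E := E)) :=
  measurable_pi_lambda _ fun n => by
    cases n with
    | zero => exact measurable_fst
    | succ n => exact (measurable_pi_apply n).comp measurable_snd

theorem map_consSeq (μ : Measure E) [IsProbabilityMeasure μ] :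
    (μ.prod (Measure.infinitePi fun _ : ℕ => μ)).map consSeq = Measure.infinitePi fun _ => μ := by
  refine eq_infinitePi_nat fun n t ht => ?_
  have hset : ∀ (n : ℕ) (t : ℕ → Set E), {ω : ℕ → E | ∀ i < n, ω i ∈ t i} =
      Set.pi (Finset.range n) t := fun n t => by
    ext
    simp
  have hmeas : ∀ (n : ℕ) (t : ℕ → Set E), (∀ i, MeasurableSet (t i)) →
      MeasurableSet {ω : ℕ → E | ∀ i < n, ω i ∈ t i} := fun n t ht => by
    rw [hset]
    exact MeasurableSet.pi (Finset.countable_toSet _) fun i _ => ht i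
  rw [Measure.map_apply measurable_consSeq (hmeas n t ht)]
  cases n with
  | zero => simp
  | succ n =>
    have hsplit : consSeq ⁻¹' {ω : ℕ → E | ∀ i < n + 1, ω i ∈ t i} =
        t 0 ×ˢ {ω | ∀ i < n, ω i ∈ t (i + 1)} := by
      ext p
      simp only [mem_ofPred_eq, mem_preimage, mem_prod]
      refine ⟨fun hω => ⟨hω 0 (by omega), fun i hi => hω (i + 1) (by omega)⟩, ?_⟩
      rintro ⟨h0, hω⟩ (_ | i) hi
      · exact h0
      · exact hω i (by omega)
    rw [hsplit, Measure.prod_prod, hset, Measure.infinitePi_pi _ fun i _ => ht (i + 1),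
      Finset.prod_range_succ', mul_comm]

/-- Second Borel–Cantelli lemma for independent events of equal positive probability. -/
theorem ae_frequently_mem (μ : Measure E) [IsProbabilityMeasure μ] {s : Set E}
    (hs : MeasurableSet s) (h : μ s ≠ 0) :
    ∀ᵐ ω ∂Measure.infinitePi fun _ : ℕ => μ, ∃ᶠ n in atTop, ω n ∈ s := by
  have hm : ∀ n : ℕ, MeasurableSet {ω : ℕ → E | ω n ∈ s} := fun n => measurable_pi_apply n hs
  have hind : iIndepSet (fun (n : ℕ) => {ω : ℕ → E | ω n ∈ s})
      (Measure.infinitePi fun _ : ℕ => μ) := by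
    have hi : iIndepFun (fun (n : ℕ) (ω : ℕ → E) => ω n) (Measure.infinitePi fun _ : ℕ => μ) :=
      iIndepFun_infinitePi (X := fun _ x => x) fun _ => measurable_id
    refine (iIndepSet_iff_meas_biInter hm).2 fun S => ?_
    exact hi.measure_inter_preimage_eq_mul S (sets := fun _ => s) fun _ _ => hs
  have hprob : ∀ n, (Measure.infinitePi fun _ : ℕ => μ) {ω : ℕ → E | ω n ∈ s} = μ s := fun n => by
    have := Measure.map_apply (μ := Measure.infinitePi fun _ : ℕ => μ) (measurable_pi_apply n) hs
    rw [Measure.infinitePi_map_eval] at this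
    exact this.symm
  have := measure_limsup_eq_one hm hind (by
    simp only [hprob]
    exact ENNReal.tsum_const_eq_top_of_ne_zero h)
  have hlim : MeasurableSet (limsup (fun n => {ω : ℕ → E | ω n ∈ s}) atTop) :=
    MeasurableSet.measurableSet_limsup hm
  rw [← prob_compl_eq_zero_iff hlim] at this
  filter_upwards [compl_mem_ae_iff.2 this] with ω hω
  rw [compl_compl, mem_limsup_iff_frequently_mem] at hω
  exact hω

/-- Infinitely many gaps exceed `1`, so the series of nonnegative gaps cannot converge. This
excludes accumulation of arrivals. -/
theorem ae_tendsto_sum_atTop {r : ℝ} (hr : 0 < r) :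
    ∀ᵐ x ∂Measure.infinitePi fun _ : ℕ => expMeasure r, (∀ n, 0 ≤ x n) ∧
      Tendsto (fun n => ∑ k ∈ Finset.range n, x k) atTop atTop := by
  have := isProbabilityMeasure_expMeasure hr
  have hpos : ∀ᵐ x ∂Measure.infinitePi fun _ : ℕ => expMeasure r, ∀ n, 0 ≤ x n := by
    rw [ae_all_iff]
    intro n
    refine ae_of_ae_map (f := fun x : ℕ → ℝ => x n) (p := fun y => 0 ≤ y)
      (measurable_pi_apply n).aemeasurable ?_
    rw [Measure.infinitePi_map_eval]
    exact ae_nonneg_expMeasure r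
  have hfreq := ae_frequently_mem (expMeasure r) (s := Ioi 1) measurableSet_Ioi (by
    rw [expMeasure_Ioi hr, if_pos zero_le_one]
    simp [Real.exp_pos])
  filter_upwards [hpos, hfreq] with x h1 h2
  refine ⟨h1, (not_summable_iff_tendsto_nat_atTop_of_nonneg h1).1 fun hsum => ?_⟩
  have h3 := hsum.tendsto_atTop_zero.eventually_lt_const (zero_lt_one)
  obtain ⟨n, hn1, hn2⟩ := (h2.and_eventually h3).exists
  exact absurd hn2 (not_lt.2 (le_of_lt hn1))

end Sequences

/-! ### Thinning of a marked renewal sequence -/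

section Thinning

open Set Filter Topology

/-- Uniqueness of the solution of the renewal equation `ρ = α + q • (shift of ρ by κ)`. -/
theorem eq_of_renewal {N : Type*} [MeasurableSpace N] {α ρ ρ' : Measure (ℝ × N)} {κ : Measure ℝ}
    [IsProbabilityMeasure κ] [IsProbabilityMeasure ρ] [IsProbabilityMeasure ρ'] {q : ℝ≥0∞}
    (hq : q < 1)
    (h : ρ = α + q • (κ.prod ρ).map fun p : ℝ × ℝ × N => (p.1 + p.2.1, p.2.2))
    (h' : ρ' = α + q • (κ.prod ρ').map fun p : ℝ × ℝ × N => (p.1 + p.2.1, p.2.2)) : ρ = ρ' := by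
  have hsh : Measurable fun p : ℝ × ℝ × N => (p.1 + p.2.1, p.2.2) := by fun_prop
  -- Applying the renewal equations `n` times leaves a discrepancy of at most `q ^ n`.
  have key : ∀ n : ℕ, ∀ s, MeasurableSet s → ρ s ≤ ρ' s + q ^ n := by
    intro n
    induction n with
    | zero =>
      intro s _
      rw [pow_zero]
      exact prob_le_one.trans le_add_self
    | succ n ih =>
      intro s hs
      have hs' := hsh hs
      have hsec : ∀ x : ℝ, MeasurableSet
          (Prod.mk x ⁻¹' ((fun p : ℝ × ℝ × N => (p.1 + p.2.1, p.2.2)) ⁻¹' s)) :=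
        fun x => measurable_prodMk_left hs'
      rw [h, h']
      simp only [Measure.add_apply, Measure.smul_apply, smul_eq_mul, Measure.map_apply hsh hs,
        Measure.prod_apply hs']
      rw [add_assoc, pow_succ', ← mul_add]
      gcongr
      calc _ ≤ ∫⁻ x, (ρ' (Prod.mk x ⁻¹' ((fun p : ℝ × ℝ × N => (p.1 + p.2.1, p.2.2)) ⁻¹' s)) +
            q ^ n) ∂κ := lintegral_mono fun x => ih _ (hsec x)
        _ = _ := by rw [lintegral_add_right _ measurable_const]; simp
  have hle : ρ ≤ ρ' := by
    refine Measure.le_iff.2 fun s hs => ?_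
    have hlim : Tendsto (fun n : ℕ => ρ' s + q ^ n) atTop (𝓝 (ρ' s + 0)) :=
      tendsto_const_nhds.add (ENNReal.tendsto_pow_atTop_nhds_zero_of_lt_one hq)
    rw [add_zero] at hlim
    exact ge_of_tendsto' hlim fun n => key n s hs
  exact Measure.eq_of_le_of_measure_univ_eq hle (by simp)

variable {M : Type*}

/-- An arrival with its retention flag. -/
abbrev Flagged (M : Type*) : Type _ := (ℝ × M) × Bool

/-- The second alternative makes the search total: if no arrival is retained, index `0` is returned.
-/
theorem exists_retained (ω : ℕ → Flagged M) : ∃ n, (ω n).2 = true ∨ ∀ k, (ω k).2 = false := by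
  by_cases h : ∃ n, (ω n).2 = true
  · obtain ⟨n, hn⟩ := h
    exact ⟨n, Or.inl hn⟩
  · push Not at h
    exact ⟨0, Or.inr fun k => by simpa using h k⟩

open Classical in
/-- Index of the first retained arrival. -/
def firstRetained (ω : ℕ → Flagged M) : ℕ := Nat.find (exists_retained ω)

/-- Time elapsed until the first retained arrival, and its mark. -/
def retainedBlock (ω : ℕ → Flagged M) : ℝ × M :=
  (∑ k ∈ Finset.range (firstRetained ω + 1), (ω k).1.1, (ω (firstRetained ω)).1.2)

/-- The arrivals after the first retained one. -/
def afterRetained (ω : ℕ → Flagged M) : ℕ → Flagged M := fun n => ω (n + (firstRetained ω + 1))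

/-- The retained arrivals. -/
def thinning (ω : ℕ → Flagged M) (n : ℕ) : ℝ × M := retainedBlock (afterRetained^[n] ω)

/-- Number of arrivals up to the `n`-th retained one, excluded. -/
def retainedCount (ω : ℕ → Flagged M) : ℕ → ℕ
  | 0 => 0
  | n + 1 => retainedCount ω n + (firstRetained (afterRetained^[n] ω) + 1)

theorem afterRetained_iterate (ω : ℕ → Flagged M) (n k : ℕ) :
    afterRetained^[n] ω k = ω (k + retainedCount ω n) := by
  induction n generalizing k with
  | zero => rfl
  | succ n ih =>
    rw [Function.iterate_succ_apply', afterRetained, ih, retainedCount]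
    congr 1
    omega

/-- Index of the `n`-th retained arrival. -/
def retainedIndex (ω : ℕ → Flagged M) (n : ℕ) : ℕ :=
  firstRetained (afterRetained^[n] ω) + retainedCount ω n

theorem strictMono_retainedIndex (ω : ℕ → Flagged M) : StrictMono (retainedIndex ω) :=
  strictMono_nat_of_lt_succ fun n => by
    simp only [retainedIndex, retainedCount]
    omega

theorem thinning_snd (ω : ℕ → Flagged M) (n : ℕ) :
    (thinning ω n).2 = (ω (retainedIndex ω n)).1.2 := by
  rw [thinning, retainedBlock, afterRetained_iterate, retainedIndex]

/-- The blocks are consecutive, so their durations telescope: retained arrivals keep their original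
arrival times. -/
theorem sum_thinning_fst (ω : ℕ → Flagged M) (n : ℕ) :
    ∑ k ∈ Finset.range n, (thinning ω k).1 =
      ∑ k ∈ Finset.range (retainedCount ω n), (ω k).1.1 := by
  induction n with
  | zero => rfl
  | succ n ih =>
    rw [Finset.sum_range_succ, ih, retainedCount, Finset.sum_range_add,
      thinning, retainedBlock]
    dsimp only
    congr 1
    refine Finset.sum_congr rfl fun k _ => ?_
    rw [afterRetained_iterate, add_comm]

theorem retainedCount_succ (ω : ℕ → Flagged M) (n : ℕ) :
    retainedCount ω (n + 1) = retainedIndex ω n + 1 := by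
  simp only [retainedIndex, retainedCount]
  omega

theorem firstRetained_eq_zero {ω : ℕ → Flagged M} (h : (ω 0).2 = true) : firstRetained ω = 0 := by
  classical
  rw [firstRetained, Nat.find_eq_zero]
  exact Or.inl h

theorem firstRetained_cons {ω : ℕ → Flagged M} (x : ℝ × M) (h : ∃ n, (ω n).2 = true) :
    firstRetained (consSeq ((x, false), ω)) = firstRetained ω + 1 := by
  classical
  have h1 : ¬ ∀ k, (ω k).2 = false := fun h' => by
    obtain ⟨n, hn⟩ := h
    simp [h' n] at hn
  have h2 : ¬ ∀ k, (consSeq ((x, false), ω) k).2 = false := fun h' => h1 fun k => h' (k + 1)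
  have hspec : (ω (firstRetained ω)).2 = true :=
    (Nat.find_spec (exists_retained ω)).resolve_right h1
  have hmin : ∀ m < firstRetained ω, (ω m).2 ≠ true := fun m hm hm' =>
    Nat.find_min (exists_retained ω) hm (Or.inl hm')
  rw [firstRetained, Nat.find_eq_iff]
  refine ⟨Or.inl hspec, fun m hm hcon => ?_⟩
  have hcon := hcon.resolve_right h2
  cases m with
  | zero => simp [consSeq] at hcon
  | succ m => exact hmin m (by omega) hcon

theorem retainedBlock_cons_true (x : ℝ × M) (ω : ℕ → Flagged M) :
    retainedBlock (consSeq ((x, true), ω)) = x := by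
  rw [retainedBlock, firstRetained_eq_zero rfl]
  simp [consSeq]

theorem afterRetained_cons_true (x : ℝ × M) (ω : ℕ → Flagged M) :
    afterRetained (consSeq ((x, true), ω)) = ω := by
  funext n
  rw [afterRetained, firstRetained_eq_zero rfl]
  rfl

theorem retainedBlock_cons_false (x : ℝ × M) {ω : ℕ → Flagged M} (h : ∃ n, (ω n).2 = true) :
    retainedBlock (consSeq ((x, false), ω)) =
      (x.1 + (retainedBlock ω).1, (retainedBlock ω).2) := by
  rw [retainedBlock, firstRetained_cons x h, Finset.sum_range_succ', add_comm]
  rfl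

theorem afterRetained_cons_false (x : ℝ × M) {ω : ℕ → Flagged M} (h : ∃ n, (ω n).2 = true) :
    afterRetained (consSeq ((x, false), ω)) = afterRetained ω := by
  funext n
  rw [afterRetained, firstRetained_cons x h]
  rfl

/-! ### Law of the thinned sequence -/

section Law

variable [MeasurableSpace M]

theorem measurable_firstRetained : Measurable (firstRetained (M := M)) := by
  classical
  have hflag : ∀ (k : ℕ) (b : Bool), MeasurableSet {ω : ℕ → Flagged M | (ω k).2 = b} :=
    fun k b => (measurable_snd.comp (measurable_pi_apply k)) (measurableSet_singleton b)
  have h : Measurable fun ω : ℕ → Flagged M => Nat.find (exists_retained ω) := by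
    refine measurable_find exists_retained fun k => ?_
    refine (hflag k true).union ?_
    have : {ω : ℕ → Flagged M | ∀ k, (ω k).2 = false} = ⋂ k, {ω | (ω k).2 = false} := by
      ext
      simp
    change MeasurableSet {ω : ℕ → Flagged M | ∀ k, (ω k).2 = false}
    rw [this]
    exact MeasurableSet.iInter fun k => hflag k false
  convert h
  rw [firstRetained]

theorem measurable_retainedBlock : Measurable (retainedBlock (M := M)) := by
  have h : Measurable fun p : ℕ × (ℕ → Flagged M) =>
      ((∑ k ∈ Finset.range (p.1 + 1), (p.2 k).1.1, (p.2 p.1).1.2) : ℝ × M) := by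
    refine measurable_from_prod_countable_right fun n => ?_
    dsimp only
    exact (Finset.measurable_sum _ fun k _ => by fun_prop).prodMk (by fun_prop)
  exact h.comp (measurable_firstRetained.prodMk measurable_id)

theorem measurable_afterRetained : Measurable (afterRetained (M := M)) := by
  have h : Measurable fun p : ℕ × (ℕ → Flagged M) => (fun n => p.2 (n + (p.1 + 1))) :=
    measurable_from_prod_countable_right fun n =>
      measurable_pi_lambda _ fun k => measurable_pi_apply (k + (n + 1))
  exact h.comp (measurable_firstRetained.prodMk measurable_id)

/-- Law of a retention flag. -/
def flagLaw (q : ℝ) : Measure Bool :=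
  ENNReal.ofReal q • Measure.dirac true + ENNReal.ofReal (1 - q) • Measure.dirac false

theorem isProbabilityMeasure_flagLaw {q : ℝ} (h0 : 0 ≤ q) (h1 : q ≤ 1) :
    IsProbabilityMeasure (flagLaw q) := by
  constructor
  simp [flagLaw, ← ENNReal.ofReal_add h0 (sub_nonneg.2 h1)]

/-- Law of the sequence of flagged arrivals. -/
def flaggedLaw (l : ℝ) (m : Measure M) (q : ℝ) : Measure (ℕ → Flagged M) :=
  Measure.infinitePi fun _ => ((expMeasure l).prod m).prod (flagLaw q)

theorem ae_exists_retained {l q : ℝ} {m : Measure M} [IsProbabilityMeasure m] (hl : 0 < l)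
    (h0 : 0 < q) (h1 : q ≤ 1) : ∀ᵐ ω ∂flaggedLaw l m q, ∃ n, (ω n).2 = true := by
  have := isProbabilityMeasure_expMeasure hl
  have := isProbabilityMeasure_flagLaw h0.le h1
  have hs : MeasurableSet {x : Flagged M | x.2 = true} :=
    measurable_snd (measurableSet_singleton true)
  filter_upwards [ae_frequently_mem (((expMeasure l).prod m).prod (flagLaw q)) hs (by
    have : {x : Flagged M | x.2 = true} = univ ×ˢ {true} := by
      ext
      simp
    rw [this, Measure.prod_prod]
    simp [flagLaw, h0])] with ω hω
  exact hω.exists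

/-- Condition on the first flag. If it is `true`, the block is the first arrival and the rest is a
fresh copy of the sequence; if it is `false`, the block is that of the remaining sequence, delayed
by an independent exponential time. This is a renewal equation for the joint law. By
`expMeasure_eq_add` the claimed product law solves it too, and the solution is unique. -/
theorem map_retainedBlock_afterRetained {l l' : ℝ} {m : Measure M} [IsProbabilityMeasure m]
    (hl : 0 < l) (hll : l ≤ l') :
    (flaggedLaw l' m (l / l')).map (fun ω => (retainedBlock ω, afterRetained ω)) =
      ((expMeasure l).prod m).prod (flaggedLaw l' m (l / l')) := by
  have hl' : 0 < l' := hl.trans_le hll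
  have hq0 : 0 < l / l' := by positivity
  have hq1 : l / l' ≤ 1 := (div_le_one hl').2 hll
  have := isProbabilityMeasure_expMeasure hl
  have := isProbabilityMeasure_expMeasure hl'
  have := isProbabilityMeasure_flagLaw hq0.le hq1
  set P := flaggedLaw l' m (l / l') with hP
  have : IsProbabilityMeasure P := by
    rw [hP, flaggedLaw]
    infer_instance
  -- Reassociated so that the delay acts on the first coordinate alone, as in `eq_of_renewal`.
  let G : (ℕ → Flagged M) → ℝ × M × (ℕ → Flagged M) := fun ω =>
    ((retainedBlock ω).1, (retainedBlock ω).2, afterRetained ω)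
  have hb := measurable_retainedBlock (M := M)
  have ha := measurable_afterRetained (M := M)
  have hG : Measurable G := hb.fst.prodMk (hb.snd.prodMk ha)
  have hsh : Measurable fun p : ℝ × ℝ × M × (ℕ → Flagged M) => (p.1 + p.2.1, p.2.2) := by fun_prop
  have hadd : Measurable fun p : ℝ × ℝ => p.1 + p.2 := by fun_prop
  have hcons := measurable_consSeq (E := Flagged M)
  have hGprob := Measure.isProbabilityMeasure_map (μ := P) hG.aemeasurable
  have hflag : ∀ b : Bool, Measurable fun p : (ℝ × M) × (ℕ → Flagged M) =>
      consSeq ((p.1, b), p.2) := fun b => hcons.comp (by fun_prop)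
  have hPsplit : P = ENNReal.ofReal (l / l') •
      (((expMeasure l').prod m).prod P).map (fun p => consSeq ((p.1, true), p.2)) +
      ENNReal.ofReal (1 - l / l') •
      (((expMeasure l').prod m).prod P).map (fun p => consSeq ((p.1, false), p.2)) := by
    have hdirac : ∀ b : Bool, ((((expMeasure l').prod m).prod (Measure.dirac b)).prod P).map
        consSeq = (((expMeasure l').prod m).prod P).map (fun p => consSeq ((p.1, b), p.2)) := by
      intro b
      rw [Measure.prod_dirac]
      have := Measure.map_prod_map ((expMeasure l').prod m) P
        (f := fun x => (x, b)) (g := id) (by fun_prop) measurable_id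
      rw [Measure.map_id] at this
      rw [this, Measure.map_map hcons (by fun_prop)]
      rfl
    conv_lhs => rw [hP, flaggedLaw, ← map_consSeq]
    change ((((expMeasure l').prod m).prod (flagLaw (l / l'))).prod P).map consSeq = _
    rw [← hdirac, ← hdirac, flagLaw, Measure.prod_add, Measure.prod_smul_right,
      Measure.prod_smul_right, Measure.add_prod, Measure.prod_smul_left, Measure.prod_smul_left,
      Measure.map_add _ _ hcons, Measure.map_smul, Measure.map_smul]
  have hassoc : ∀ (κ : Measure ℝ) [IsProbabilityMeasure κ], ((κ.prod m).prod P).map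
      (fun p => (p.1.1, p.1.2, p.2)) = κ.prod (m.prod P) := fun κ _ =>
    (measurePreserving_prodAssoc κ m P).map_eq
  have hQ : P.map G = ENNReal.ofReal (l / l') • (expMeasure l').prod (m.prod P) +
      ENNReal.ofReal (1 - l / l') • ((expMeasure l').prod (P.map G)).map
        fun p : ℝ × ℝ × M × (ℕ → Flagged M) => (p.1 + p.2.1, p.2.2) := by
    have htrue : (((expMeasure l').prod m).prod P).map (G ∘ fun p => consSeq ((p.1, true), p.2)) =
        (expMeasure l').prod (m.prod P) := by
      rw [← hassoc]
      congr 1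
      funext p
      simp only [G, Function.comp_apply, retainedBlock_cons_true, afterRetained_cons_true]
    have hfalse : (((expMeasure l').prod m).prod P).map
        (G ∘ fun p => consSeq ((p.1, false), p.2)) = ((expMeasure l').prod (P.map G)).map
        fun p : ℝ × ℝ × M × (ℕ → Flagged M) => (p.1 + p.2.1, p.2.2) := by
      have hae : ∀ᵐ p ∂((expMeasure l').prod m).prod P, ∃ n, (p.2 n).2 = true :=
        Measure.quasiMeasurePreserving_snd.ae (ae_exists_retained hl' hq0 hq1)
      have h1 : (G ∘ fun p : (ℝ × M) × (ℕ → Flagged M) => consSeq ((p.1, false), p.2))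
          =ᵐ[((expMeasure l').prod m).prod P]
          (fun p : ℝ × ℝ × M × (ℕ → Flagged M) => (p.1 + p.2.1, p.2.2)) ∘
            Prod.map Prod.fst G := by
        filter_upwards [hae] with p hp
        simp only [G, Function.comp_apply, retainedBlock_cons_false _ hp,
          afterRetained_cons_false _ hp, Prod.map]
      rw [Measure.map_congr h1, ← Measure.map_map hsh (by fun_prop),
        ← Measure.map_prod_map _ _ measurable_fst hG]
      have hfst : ((expMeasure l').prod m).map Prod.fst = expMeasure l' := by
        simp
      rw [hfst]
    conv_lhs => rw [hPsplit]
    rw [Measure.map_add _ _ hG, Measure.map_smul, Measure.map_smul,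
      Measure.map_map hG (hflag true), Measure.map_map hG (hflag false), htrue, hfalse]
  have hQ' : (expMeasure l).prod (m.prod P) =
      ENNReal.ofReal (l / l') • (expMeasure l').prod (m.prod P) +
      ENNReal.ofReal (1 - l / l') • ((expMeasure l').prod ((expMeasure l).prod (m.prod P))).map
        fun p : ℝ × ℝ × M × (ℕ → Flagged M) => (p.1 + p.2.1, p.2.2) := by
    have hconv : (((expMeasure l').prod (expMeasure l)).map fun p => p.1 + p.2).prod (m.prod P) =
        ((expMeasure l').prod ((expMeasure l).prod (m.prod P))).map
        fun p : ℝ × ℝ × M × (ℕ → Flagged M) => (p.1 + p.2.1, p.2.2) := by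
      have h1 := Measure.map_prod_map ((expMeasure l').prod (expMeasure l)) (m.prod P)
        hadd measurable_id
      rw [Measure.map_id] at h1
      rw [h1, ← (measurePreserving_prodAssoc (expMeasure l') (expMeasure l) (m.prod P)).map_eq,
        Measure.map_map hsh (by fun_prop)]
      rfl
    conv_lhs => rw [expMeasure_eq_add hl hll]
    have hprob := Measure.isProbabilityMeasure_map
      (μ := (expMeasure l').prod (expMeasure l)) hadd.aemeasurable
    rw [Measure.add_prod, Measure.prod_smul_left, Measure.prod_smul_left, hconv]
  have heq := eq_of_renewal (ENNReal.ofReal_lt_one.2 (by linarith)) hQ hQ'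
  have hcomp : (fun ω : ℕ → Flagged M => (retainedBlock ω, afterRetained ω)) =
      (MeasurableEquiv.prodAssoc.symm : ℝ × M × (ℕ → Flagged M) → _) ∘ G := rfl
  rw [hcomp, ← Measure.map_map (by fun_prop) hG, heq,
    ← (measurePreserving_prodAssoc (expMeasure l) m P).map_eq, Measure.map_map (by fun_prop)
    (by fun_prop), MeasurableEquiv.symm_comp_self, Measure.map_id]

/-- Thinning: keeping each arrival of a marked Poisson stream of rate `l'` with probability
`l / l'` yields a marked Poisson stream of rate `l`. -/
theorem map_thinning {l l' : ℝ} {m : Measure M} [IsProbabilityMeasure m] (hl : 0 < l)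
    (hll : l ≤ l') : (flaggedLaw l' m (l / l')).map thinning =
      Measure.infinitePi fun _ => (expMeasure l).prod m := by
  have hl' : 0 < l' := hl.trans_le hll
  have hq0 : 0 < l / l' := by positivity
  have hq1 : l / l' ≤ 1 := (div_le_one hl').2 hll
  have := isProbabilityMeasure_expMeasure hl
  have := isProbabilityMeasure_expMeasure hl'
  have := isProbabilityMeasure_flagLaw hq0.le hq1
  have : IsProbabilityMeasure (flaggedLaw l' m (l / l')) := by
    rw [flaggedLaw]
    infer_instance
  exact map_iterate_eq_infinitePi measurable_retainedBlock measurable_afterRetained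
    (map_retainedBlock_afterRetained hl hll)

theorem measurable_thinning : Measurable (thinning (M := M)) :=
  measurable_pi_lambda _ fun n =>
    measurable_retainedBlock.comp (measurable_afterRetained.iterate n)

end Law

end Thinning

/-! ### The law of the input -/

section InputLaw

open Set Filter Topology

variable {a : ℝ} [Fact (0 < a)] {K : ℕ}

theorem isProbabilityMeasure_dipoleLaw (r : ℝ≥0) : IsProbabilityMeasure (dipoleLaw a r) := by
  have : IsProbabilityMeasure (cond (volume : Measure ℝ) (Ioc 0 (2 * Real.pi))) := by
    refine cond_isProbabilityMeasure_of_finite ?_ ?_ <;> rw [Real.volume_Ioc]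
    · simp [Real.pi_pos]
    · exact ENNReal.ofReal_ne_top
  refine Measure.isProbabilityMeasure_map (Continuous.measurable ?_).aemeasurable
  have hcoe : Continuous fun x : ℝ => (x : AddCircle a) := AddCircle.continuous_mk' a
  have h1 : Continuous fun x : ℝ => (((r : ℝ) * Real.cos x : ℝ) : AddCircle a) :=
    hcoe.comp (by fun_prop)
  have h2 : Continuous fun x : ℝ => (((r : ℝ) * Real.sin x : ℝ) : AddCircle a) :=
    hcoe.comp (by fun_prop)
  fun_prop

theorem isProbabilityMeasure_markLaw (r : ℝ≥0) (p : PMF (Cls K)) {L : Cls K → ℝ}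
    (hL : ∀ C, 0 < L C) : IsProbabilityMeasure (markLaw (a := a) r p L) := by
  have := isProbabilityMeasure_dipoleLaw (a := a) r
  have := fun C => isProbabilityMeasure_expMeasure (one_div_pos.2 (hL C))
  have := fun C : Cls K => Measure.isProbabilityMeasure_map (μ := dipoleLaw a r)
    (f := fun q => ((q, C) : User a K)) (by fun_prop)
  constructor
  simp only [markLaw, Measure.coe_finsetSum, Finset.sum_apply, Measure.smul_apply, measure_univ,
    smul_eq_mul, mul_one]
  rw [← tsum_fintype (L := .unconditional _), p.tsum_coe]

theorem measurable_scaleFile {a : ℝ} (k : Cls K → ℝ) :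
    Measurable fun x : User a K × ℝ => (x.1, x.2 * k x.1.2) := by
  have : Measurable k := measurable_of_countable k
  fun_prop

theorem markLaw_map_scaleFile (r : ℝ≥0) (p : PMF (Cls K)) {L L' : Cls K → ℝ}
    (hL : ∀ C, 0 < L C) (hL' : ∀ C, 0 < L' C) :
    (markLaw (a := a) r p L').map (fun x => (x.1, x.2 * (L x.1.2 / L' x.1.2))) =
      markLaw r p L := by
  have := isProbabilityMeasure_dipoleLaw (a := a) r
  have := fun C => isProbabilityMeasure_expMeasure (one_div_pos.2 (hL C))
  have := fun C => isProbabilityMeasure_expMeasure (one_div_pos.2 (hL' C))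
  have hm := measurable_scaleFile (a := a) fun C : Cls K => L C / L' C
  have hC : ∀ C : Cls K, (((dipoleLaw a r).map fun q => ((q, C) : User a K)).prod
      (expMeasure (1 / L' C))).map (fun x => (x.1, x.2 * (L x.1.2 / L' x.1.2))) =
      ((dipoleLaw a r).map fun q => ((q, C) : User a K)).prod (expMeasure (1 / L C)) := by
    intro C
    have hmC : Measurable fun q : Torus a × Torus a => ((q, C) : User a K) := by fun_prop
    have h1 : expMeasure (1 / L C) = (expMeasure (1 / L' C)).map fun x => x * (L C / L' C) := by
      rw [expMeasure_map_mul (one_div_pos.2 (hL' C)) (div_pos (hL C) (hL' C))]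
      congr 1
      have := (hL C).ne'
      have := (hL' C).ne'
      field_simp
    have h2 := Measure.map_prod_map (dipoleLaw a r) (expMeasure (1 / L' C)) hmC measurable_id
    rw [Measure.map_id] at h2
    rw [h1, Measure.map_prod_map _ _ hmC (by fun_prop), h2, Measure.map_map hm (by fun_prop)]
    rfl
  refine Measure.ext fun s hs => ?_
  rw [Measure.map_apply hm hs]
  simp only [markLaw, Measure.coe_finsetSum, Finset.sum_apply, Measure.smul_apply]
  refine Finset.sum_congr rfl fun C _ => ?_
  rw [← hC C, Measure.map_apply hm hs]

/-- The law of the input. -/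
def inputLaw (r : ℝ≥0) (p : PMF (Cls K)) (Δ : Params a K) : Measure (Input Δ.init) :=
  (Measure.infinitePi fun _ : ℕ => (expMeasure (Δ.lam * a ^ 2)).prod (markLaw r p Δ.L)).prod
    (Measure.infinitePi fun i => expMeasure (1 / Δ.L i.1.2))

variable {r : ℝ≥0} {p : PMF (Cls K)} {Δ : Params a K}

theorem mul_sq_pos_of_fact {l : ℝ} (hl : 0 < l) : 0 < l * a ^ 2 :=
  mul_pos hl (pow_pos (Fact.out : 0 < a) 2)

theorem isProbabilityMeasure_arrival (hlam : 0 < Δ.lam) (hL : ∀ C, 0 < Δ.L C) :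
    IsProbabilityMeasure ((expMeasure (Δ.lam * a ^ 2)).prod (markLaw (a := a) r p Δ.L)) := by
  have := isProbabilityMeasure_markLaw (a := a) r p hL
  have := isProbabilityMeasure_expMeasure (mul_sq_pos_of_fact (a := a) hlam)
  infer_instance

theorem IsInput.hasLaw {Ω : Type u} [MeasurableSpace Ω] {P : Measure Ω} [IsProbabilityMeasure P]
    {d : Ω → Input Δ.init} (hd : IsInput r p Δ P d) : HasLaw d (inputLaw r p Δ) P := by
  have h1 := hd.arrival_indep.hasLaw_infinitePi hd.arrival_law
    (aemeasurable_pi_iff.2 fun n => (hd.arrival_law n).aemeasurable)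
  have h2 := hd.init_indep.hasLaw_infinitePi hd.init_law
    (aemeasurable_pi_iff.2 fun n => (hd.init_law n).aemeasurable)
  exact (indepFun_iff_hasLaw_prodMk_prod h1 h2).1 hd.indep

theorem isInput_of_hasLaw (hlam : 0 < Δ.lam) (hL : ∀ C, 0 < Δ.L C) {Ω : Type u}
    [MeasurableSpace Ω] {P : Measure Ω} [IsProbabilityMeasure P] {d : Ω → Input Δ.init}
    (hd : HasLaw d (inputLaw r p Δ) P) : IsInput r p Δ P d := by
  have := isProbabilityMeasure_arrival (r := r) (p := p) hlam hL
  have := fun C => isProbabilityMeasure_expMeasure (one_div_pos.2 (hL C))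
  have h1 : HasLaw (fun ω => (d ω).1) (Measure.infinitePi fun _ : ℕ =>
      (expMeasure (Δ.lam * a ^ 2)).prod (markLaw r p Δ.L)) P :=
    (measurePreserving_fst (ν := Measure.infinitePi fun i : Δ.init.ToType =>
      expMeasure (1 / Δ.L i.1.2))).fun_comp_hasLaw hd
  have h2 : HasLaw (fun ω => (d ω).2) (Measure.infinitePi fun i => expMeasure (1 / Δ.L i.1.2)) P :=
    (measurePreserving_snd (μ := Measure.infinitePi fun _ : ℕ =>
      (expMeasure (Δ.lam * a ^ 2)).prod (markLaw r p Δ.L))).fun_comp_hasLaw hd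
  have h3 : ∀ n, HasLaw (fun ω => (d ω).1 n)
      ((expMeasure (Δ.lam * a ^ 2)).prod (markLaw r p Δ.L)) P := fun n =>
    (measurePreserving_eval_infinitePi (fun _ : ℕ =>
      (expMeasure (Δ.lam * a ^ 2)).prod (markLaw r p Δ.L)) n).fun_comp_hasLaw h1
  have h4 : ∀ i, HasLaw (fun ω => (d ω).2 i) (expMeasure (1 / Δ.L i.1.2)) P := fun i =>
    (measurePreserving_eval_infinitePi (fun i : Δ.init.ToType =>
      expMeasure (1 / Δ.L i.1.2)) i).fun_comp_hasLaw h2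
  exact ⟨h3, (iIndepFun_iff_hasLaw_Pi_infinitePi h3 h1.aemeasurable).2 h1, h4,
    (iIndepFun_iff_hasLaw_Pi_infinitePi h4 h2.aemeasurable).2 h2,
    (indepFun_iff_hasLaw_prodMk_prod h1 h2).2 hd⟩

theorem ae_nonExplosive (hlam : 0 < Δ.lam) (hL : ∀ C, 0 < Δ.L C) :
    ∀ᵐ d ∂inputLaw r p Δ, d.NonExplosive := by
  have := isProbabilityMeasure_markLaw (a := a) r p hL
  have hlam' := mul_sq_pos_of_fact (a := a) hlam
  have := isProbabilityMeasure_expMeasure hlam'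
  have := fun C => isProbabilityMeasure_expMeasure (one_div_pos.2 (hL C))
  have hfst : ((expMeasure (Δ.lam * a ^ 2)).prod (markLaw (a := a) r p Δ.L)).map Prod.fst =
      expMeasure (Δ.lam * a ^ 2) := by
    simp
  have h1 := Measure.infinitePi_map_pi (fun _ : ℕ => (expMeasure (Δ.lam * a ^ 2)).prod
    (markLaw (a := a) r p Δ.L)) (f := fun _ => Prod.fst) fun _ => measurable_fst
  simp only [hfst] at h1
  have h2 := ae_tendsto_sum_atTop hlam'
  rw [← h1] at h2
  have hm : Measurable fun (x : ℕ → ℝ × User a K × ℝ) (n : ℕ) => (x n).1 := by fun_prop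
  have h3 := ae_of_ae_map hm.aemeasurable h2
  filter_upwards [Measure.quasiMeasurePreserving_fst.ae h3] with d hd
  exact ⟨hd.1, hd.2⟩

/-- The integrand is almost surely a measurable function of the input, so only the law of the input
matters. This makes realizations on different spaces comparable. -/
theorem IsRealization.lintegral_eq (hlam : 0 < Δ.lam) (hL : ∀ C, 0 < Δ.L C)
    (hR : Measurable (Function.uncurry Δ.R)) {Ω : Type u} [MeasurableSpace Ω] {P : Measure Ω}
    [IsProbabilityMeasure P] {X : ℝ → Ω → Config a K} (hX : IsRealization r p Δ P X) {n : ℕ}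
    {t : Fin n → ℝ} (ht : ∀ i, 0 ≤ t i) {f : (Fin n → Config a K) → ℝ≥0∞} (hf : Measurable f) :
    ∫⁻ ω, f (fun i => X (t i) ω) ∂P =
      ∫⁻ d, f (fun i => d.path Δ.R (t i)) ∂inputLaw r p Δ := by
  obtain ⟨d, hd, hX⟩ := hX
  have hlaw := hd.hasLaw
  have hne : ∀ᵐ ω ∂P, (d ω).NonExplosive :=
    ae_of_ae_map hlaw.aemeasurable (hlaw.map_eq ▸ ae_nonExplosive hlam hL)
  have hm : Measurable fun d : Input Δ.init => f fun i => d.path Δ.R (t i) :=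
    hf.comp (measurable_pi_lambda _ fun i => measurable_path hR (t i))
  rw [← hlaw.lintegral_comp hm.aemeasurable]
  refine lintegral_congr_ae ?_
  filter_upwards [hne, hX] with ω h1 h2
  congr 1
  funext i
  exact h2.eq_path h1 (ht i)

end InputLaw

/-! ### The coupling -/

section Coupling

open Set Filter Topology

variable {a : ℝ} {K : ℕ} {Φ₀ Φ₀' : Config a K}

open Classical in
/-- The initial users of the smaller configuration, seen in the larger one. -/
def embedInit (h : Φ₀ ≤ Φ₀') (i : Φ₀.ToType) : Φ₀'.ToType :=
  ⟨i.1, Fin.castLE (Multiset.count_le_of_le i.1 h) i.2⟩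

theorem embedInit_injective (h : Φ₀ ≤ Φ₀') : Function.Injective (embedInit h) := by
  rintro ⟨x, i⟩ ⟨y, j⟩ hxy
  obtain ⟨rfl, hij⟩ := Sigma.mk.inj_iff.1 hxy
  exact congrArg (Sigma.mk x) (Fin.castLE_injective _ (eq_of_heq hij))

/-- The larger input is read off the flagged arrivals. -/
def coupledUpper (ω : (ℕ → Flagged (User a K × ℝ)) × (Φ₀'.ToType → ℝ)) : Input Φ₀' :=
  (fun n => (ω.1 n).1, ω.2)

/-- The smaller input: arrivals are thinned and files are scaled down. -/
def coupledLower (h : Φ₀ ≤ Φ₀') (k : Cls K → ℝ)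
    (ω : (ℕ → Flagged (User a K × ℝ)) × (Φ₀'.ToType → ℝ)) : Input Φ₀ :=
  (fun n => ((thinning ω.1 n).1, (thinning ω.1 n).2.1,
    (thinning ω.1 n).2.2 * k (thinning ω.1 n).2.1.2),
    fun i => ω.2 (embedInit h i) * k i.1.2)

variable {r : ℝ≥0} {p : PMF (Cls K)} {lam lam' : ℝ} {L L' : Cls K → ℝ} {R R' : Rate a K}

/-- The law on which both inputs are realized. -/
def couplingLaw [Fact (0 < a)] (Φ₀' : Config a K) (r : ℝ≥0) (p : PMF (Cls K)) (lam lam' : ℝ) (L' : Cls K → ℝ) :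
    Measure ((ℕ → Flagged (User a K × ℝ)) × (Φ₀'.ToType → ℝ)) :=
  (flaggedLaw (lam' * a ^ 2) (markLaw r p L') (lam * a ^ 2 / (lam' * a ^ 2))).prod
    (Measure.infinitePi fun i => expMeasure (1 / L' i.1.2))

theorem isProbabilityMeasure_flaggedLaw {M : Type*} [MeasurableSpace M] {m : Measure M}
    [IsProbabilityMeasure m] {l l' : ℝ} (hl : 0 < l) (hll : l ≤ l') :
    IsProbabilityMeasure (flaggedLaw l' m (l / l')) := by
  have hl' : 0 < l' := hl.trans_le hll
  have := isProbabilityMeasure_expMeasure hl'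
  have := isProbabilityMeasure_flagLaw (q := l / l') (by positivity) ((div_le_one hl').2 hll)
  rw [flaggedLaw]
  infer_instance

theorem isProbabilityMeasure_couplingLaw [Fact (0 < a)] (hlam : 0 < lam) (hll : lam ≤ lam')
    (hL' : ∀ C, 0 < L' C) : IsProbabilityMeasure (couplingLaw Φ₀' r p lam lam' L') := by
  have := isProbabilityMeasure_markLaw (a := a) r p hL'
  have := isProbabilityMeasure_flaggedLaw (m := markLaw (a := a) r p L')
    (mul_sq_pos_of_fact (a := a) hlam) (mul_le_mul_of_nonneg_right hll (sq_nonneg a))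
  have := fun C => isProbabilityMeasure_expMeasure (one_div_pos.2 (hL' C))
  rw [couplingLaw]
  infer_instance

theorem hasLaw_coupledUpper [Fact (0 < a)] (hlam : 0 < lam) (hll : lam ≤ lam') (hL' : ∀ C, 0 < L' C) :
    HasLaw coupledUpper (inputLaw r p ⟨Φ₀', lam', L', R'⟩)
      (couplingLaw Φ₀' r p lam lam' L') := by
  have := isProbabilityMeasure_markLaw (a := a) r p hL'
  have h0 := mul_sq_pos_of_fact (a := a) hlam
  have h1 : lam * a ^ 2 ≤ lam' * a ^ 2 := mul_le_mul_of_nonneg_right hll (sq_nonneg a)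
  have h0' := h0.trans_le h1
  have := isProbabilityMeasure_flaggedLaw (m := markLaw (a := a) r p L') h0 h1
  have := isProbabilityMeasure_expMeasure h0'
  have := isProbabilityMeasure_flagLaw (q := lam * a ^ 2 / (lam' * a ^ 2)) (by positivity)
    ((div_le_one h0').2 h1)
  have := fun C => isProbabilityMeasure_expMeasure (one_div_pos.2 (hL' C))
  have hm : Measurable fun (x : ℕ → Flagged (User a K × ℝ)) (n : ℕ) => (x n).1 := by fun_prop
  refine ⟨(hm.comp measurable_fst).prodMk measurable_snd |>.aemeasurable, ?_⟩
  have h2 := Measure.infinitePi_map_pi (fun _ : ℕ => ((expMeasure (lam' * a ^ 2)).prod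
    (markLaw (a := a) r p L')).prod (flagLaw (lam * a ^ 2 / (lam' * a ^ 2))))
    (f := fun _ => Prod.fst) fun _ => measurable_fst
  have hfst : (((expMeasure (lam' * a ^ 2)).prod (markLaw (a := a) r p L')).prod
      (flagLaw (lam * a ^ 2 / (lam' * a ^ 2)))).map Prod.fst =
      (expMeasure (lam' * a ^ 2)).prod (markLaw r p L') := by
    rw [Measure.map_fst_prod, measure_univ, one_smul]
  simp only [hfst] at h2
  have h3 := Measure.map_prod_map (flaggedLaw (lam' * a ^ 2) (markLaw (a := a) r p L')
    (lam * a ^ 2 / (lam' * a ^ 2))) (Measure.infinitePi fun i : Φ₀'.ToType =>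
    expMeasure (1 / L' i.1.2)) hm measurable_id
  rw [Measure.map_id] at h3
  rw [inputLaw, ← h2]
  exact h3.symm

theorem hasLaw_coupledLower [Fact (0 < a)] (h : Φ₀ ≤ Φ₀') (hlam : 0 < lam) (hll : lam ≤ lam')
    (hL : ∀ C, 0 < L C) (hL' : ∀ C, 0 < L' C) :
    HasLaw (coupledLower h fun C => L C / L' C) (inputLaw r p ⟨Φ₀, lam, L, R⟩)
      (couplingLaw Φ₀' r p lam lam' L') := by
  have := isProbabilityMeasure_markLaw (a := a) r p hL
  have := isProbabilityMeasure_markLaw (a := a) r p hL'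
  have h0 := mul_sq_pos_of_fact (a := a) hlam
  have h1 : lam * a ^ 2 ≤ lam' * a ^ 2 := mul_le_mul_of_nonneg_right hll (sq_nonneg a)
  have := isProbabilityMeasure_flaggedLaw (m := markLaw (a := a) r p L') h0 h1
  have := isProbabilityMeasure_expMeasure h0
  have := fun C => isProbabilityMeasure_expMeasure (one_div_pos.2 (hL C))
  have := fun C => isProbabilityMeasure_expMeasure (one_div_pos.2 (hL' C))
  have hscale := measurable_scaleFile (a := a) fun C : Cls K => L C / L' C
  let g : ℝ × User a K × ℝ → ℝ × User a K × ℝ :=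
    Prod.map id fun x => (x.1, x.2 * (L x.1.2 / L' x.1.2))
  have hg : Measurable g := measurable_id.prodMap hscale
  let d₁ : (ℕ → Flagged (User a K × ℝ)) → ℕ → ℝ × User a K × ℝ := fun x n => g (thinning x n)
  have hd₁ : Measurable d₁ := measurable_pi_lambda _ fun n =>
    hg.comp ((measurable_pi_apply n).comp measurable_thinning)
  let d₂ : (Φ₀'.ToType → ℝ) → Φ₀.ToType → ℝ := fun y i =>
    y (embedInit h i) * (L i.1.2 / L' i.1.2)
  have hd₂ : Measurable d₂ := by fun_prop
  have hmap₁ : (flaggedLaw (lam' * a ^ 2) (markLaw (a := a) r p L')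
      (lam * a ^ 2 / (lam' * a ^ 2))).map d₁ =
      Measure.infinitePi fun _ : ℕ => (expMeasure (lam * a ^ 2)).prod (markLaw r p L) := by
    have hpi : Measurable fun (x : ℕ → ℝ × User a K × ℝ) (n : ℕ) => g (x n) :=
      measurable_pi_lambda _ fun n => hg.comp (measurable_pi_apply n)
    have hcomp : d₁ = (fun (x : ℕ → ℝ × User a K × ℝ) (n : ℕ) => g (x n)) ∘ thinning := rfl
    rw [hcomp, ← Measure.map_map hpi measurable_thinning, map_thinning h0 h1,
      Measure.infinitePi_map_pi _ fun _ => hg, ← Measure.map_prod_map _ _ measurable_id hscale,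
      Measure.map_id, markLaw_map_scaleFile r p hL hL']
  have hmap₂ : (Measure.infinitePi fun i : Φ₀'.ToType => expMeasure (1 / L' i.1.2)).map d₂ =
      Measure.infinitePi fun i => expMeasure (1 / L i.1.2) := by
    have hpi : Measurable fun (y : Φ₀.ToType → ℝ) i => y i * (L i.1.2 / L' i.1.2) := by fun_prop
    -- Restriction along an injection followed by scaling: the first preserves independence because
    -- distinct labels read distinct coordinates.
    have hcomp : d₂ = (fun (y : Φ₀.ToType → ℝ) i => y i * (L i.1.2 / L' i.1.2)) ∘
      fun y i => y (embedInit h i) := rfl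
    rw [hcomp, ← Measure.map_map hpi (by fun_prop),
      Measure.map_infinitePi_infinitePi_of_inj (embedInit_injective h)]
    rw [Measure.infinitePi_map_pi (fun i : Φ₀.ToType => expMeasure (1 / L' (embedInit h i).1.2))
      (f := fun i x => x * (L i.1.2 / L' i.1.2)) fun i => by fun_prop]
    congr 1
    funext i
    change (expMeasure (1 / L' i.1.2)).map _ = _
    rw [expMeasure_map_mul (one_div_pos.2 (hL' _)) (div_pos (hL _) (hL' _))]
    congr 1
    have := (hL i.1.2).ne'
    have := (hL' i.1.2).ne'
    field_simp
  refine ⟨(hd₁.comp measurable_fst).prodMk (hd₂.comp measurable_snd) |>.aemeasurable, ?_⟩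
  rw [inputLaw, ← hmap₁, ← hmap₂]
  exact (Measure.map_prod_map _ _ hd₁ hd₂).symm

theorem path_coupledLower_le (h : Φ₀ ≤ Φ₀') {k : Cls K → ℝ} (hk0 : ∀ C, 0 ≤ k C)
    (hk1 : ∀ C, k C ≤ 1) (hR : ∀ Ψ Ψ' : Config a K, Ψ ≤ Ψ' → ∀ w ∈ Ψ, R' w Ψ' ≤ R w Ψ)
    {ω : (ℕ → Flagged (User a K × ℝ)) × (Φ₀'.ToType → ℝ)}
    (hω : (coupledLower h k ω).NonExplosive) (hω' : (coupledUpper ω).NonExplosive) {t : ℝ}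
    (ht : 0 ≤ t) : (coupledLower h k ω).path R t ≤ (coupledUpper ω).path R' t := by
  -- Truncation at `0` makes this true for negative `x` as well, so no almost sure positivity of
  -- files is needed.
  have hscale : ∀ (x : ℝ) (C : Cls K), ENNReal.ofReal (x * k C) ≤ ENNReal.ofReal x := by
    intro x C
    rcases le_total 0 x with hx | hx
    · exact ENNReal.ofReal_le_ofReal (mul_le_of_le_one_right hx (hk1 C))
    · rw [ENNReal.ofReal_of_nonpos (mul_nonpos_of_nonpos_of_nonneg hx (hk0 C))]
      exact zero_le
  refine Input.path_le_path hω hω' hR (J := Sum.map (embedInit h) (retainedIndex ω.1))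
    (Sum.map_injective.2 ⟨embedInit_injective h, (strictMono_retainedIndex ω.1).injective⟩)
    ?_ ?_ ?_ ht
  · rintro (i | n)
    · rfl
    · change ∑ k ∈ Finset.range (retainedIndex ω.1 n + 1), (ω.1 k).1.1 =
        ∑ k ∈ Finset.range (n + 1), (thinning ω.1 k).1
      rw [sum_thinning_fst, retainedCount_succ]
  · rintro (i | n)
    · rfl
    · change (ω.1 (retainedIndex ω.1 n)).1.2.1 = (thinning ω.1 n).2.1
      rw [thinning_snd]
  · rintro (i | n)
    · exact hscale _ _
    · change ENNReal.ofReal ((thinning ω.1 n).2.2 * k (thinning ω.1 n).2.1.2) ≤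
        ENNReal.ofReal (ω.1 (retainedIndex ω.1 n)).1.2.2
      rw [thinning_snd]
      exact hscale _ _

theorem dominates_of_rate_le [Fact (0 < a)] (hlam : 0 < lam) (hll : lam ≤ lam') (hL : ∀ C, 0 < L C)
    (hLL : ∀ C, L C ≤ L' C) (h : Φ₀ ≤ Φ₀') (hRm : Measurable (Function.uncurry R))
    (hRm' : Measurable (Function.uncurry R'))
    (hR : ∀ Ψ Ψ' : Config a K, Ψ ≤ Ψ' → ∀ w ∈ Ψ, R' w Ψ' ≤ R w Ψ) :
    Dominates.{u, v} r p ⟨Φ₀', lam', L', R'⟩ ⟨Φ₀, lam, L, R⟩ := by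
  have hL' : ∀ C, 0 < L' C := fun C => (hL C).trans_le (hLL C)
  have hlam' : 0 < lam' := hlam.trans_le hll
  have hP := isProbabilityMeasure_couplingLaw (Φ₀' := Φ₀') (r := r) (p := p) hlam hll hL'
  have hlow := hasLaw_coupledLower (r := r) (p := p) (R := R) h hlam hll hL hL'
  have hup := hasLaw_coupledUpper (Φ₀' := Φ₀') (r := r) (p := p) (R' := R') hlam hll hL'
  have hne : ∀ᵐ ω ∂couplingLaw Φ₀' r p lam lam' L',
      (coupledLower h (fun C => L C / L' C) ω).NonExplosive :=
    ae_of_ae_map hlow.aemeasurable (hlow.map_eq ▸ ae_nonExplosive hlam hL)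
  have hne' : ∀ᵐ ω ∂couplingLaw Φ₀' r p lam lam' L', (coupledUpper ω).NonExplosive :=
    ae_of_ae_map hup.aemeasurable (hup.map_eq ▸ ae_nonExplosive hlam' hL')
  have hle : ∀ᵐ ω ∂couplingLaw Φ₀' r p lam lam' L', ∀ t : ℝ, 0 ≤ t →
      (coupledLower h (fun C => L C / L' C) ω).path R t ≤ (coupledUpper ω).path R' t := by
    filter_upwards [hne, hne'] with ω h1 h2 t ht
    exact path_coupledLower_le h (fun C => (div_pos (hL C) (hL' C)).le)
      (fun C => (div_le_one (hL' C)).2 (hLL C)) hR h1 h2 ht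
  refine ⟨⟨_, _, couplingLaw Φ₀' r p lam lam' L',
    fun t ω => (coupledLower h (fun C => L C / L' C) ω).path R t,
    fun t ω => (coupledUpper ω).path R' t, hP,
    ⟨_, isInput_of_hasLaw hlam hL hlow, ?_⟩, ⟨_, isInput_of_hasLaw hlam' hL' hup, ?_⟩, hle⟩, ?_⟩
  · filter_upwards [hne] with ω hω using hω.isTrajectory_path R
  · filter_upwards [hne'] with ω hω using hω.isTrajectory_path R'
  · intro Ω _ P _ Ω' _ P' _ X X' hX hX' n t ht f hf hmono
    rw [hX.lintegral_eq hlam hL hRm ht hf, hX'.lintegral_eq hlam' hL' hRm' ht hf]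
    have hm : Measurable fun d : Input Φ₀ => f fun i => d.path R (t i) :=
      hf.comp (measurable_pi_lambda _ fun i => measurable_path hRm (t i))
    have hm' : Measurable fun d : Input Φ₀' => f fun i => d.path R' (t i) :=
      hf.comp (measurable_pi_lambda _ fun i => measurable_path hRm' (t i))
    rw [← hlow.lintegral_comp hm.aemeasurable, ← hup.lintegral_comp hm'.aemeasurable]
    refine lintegral_mono_ae ?_
    filter_upwards [hle] with ω hω
    exact hmono fun i => hω (t i) (ht i)

end Coupling

/-! ### The rate of transmission -/

section PathLoss

open Set

variable {a : ℝ} {K : ℕ}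

theorem interference_le_interference (ell : ℝ≥0 → ℝ≥0) (w : User a K) {Ψ Ψ' : Config a K}
    (h : Ψ ≤ Ψ') : interference ell w Ψ ≤ interference ell w Ψ' := by
  classical
  obtain ⟨Θ, hΘ⟩ := Multiset.le_iff_exists_add.1
    (Multiset.map_le_map (f := fun z : User a K =>
      ((w.bands ∩ z.bands).card : ℝ≥0) * ell (torusDist w.rx z.tx)) (Multiset.erase_le_erase w h))
  have h1 : interference ell w Ψ' = interference ell w Ψ + Θ.sum := by
    rw [interference, interference, ← Multiset.sum_add]
    convert congrArg Multiset.sum hΘ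
  exact h1 ▸ le_self_add

/-- Positive noise keeps the denominators away from `0`, where division by zero would break
monotonicity. -/
theorem pathLossRate_le (ell : ℝ≥0 → ℝ≥0) (r : ℝ≥0) {N0 : ℝ≥0} (hN : 0 < N0) (w : User a K)
    {Ψ Ψ' : Config a K} (h : Ψ ≤ Ψ') : pathLossRate ell r N0 w Ψ' ≤ pathLossRate ell r N0 w Ψ := by
  have := interference_le_interference ell w h
  unfold pathLossRate
  gcongr

/-! ### Joint measurability of the path-loss rate -/

theorem Config.toMeasure_univ (Ψ : Config a K) : Ψ.toMeasure univ = (Ψ.card : ℝ≥0∞) := by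
  rw [Config.toMeasure_apply _ MeasurableSet.univ]
  simp

theorem Config.lintegral_toMeasure (Ψ : Config a K) {f : User a K → ℝ≥0∞} (hf : Measurable f) :
    ∫⁻ z, f z ∂Ψ.toMeasure = (Ψ.map f).sum := by
  induction Ψ using Multiset.induction_on with
  | empty => simp [Config.toMeasure]
  | cons w Ψ ih =>
    simp only [Config.toMeasure, Multiset.map_cons, Multiset.sum_cons] at ih ⊢
    rw [lintegral_add_measure, ih, lintegral_dirac' _ hf]

/-- The sum is an integral against the counting-measure kernel. Its mass is unbounded, so it is cut
by cardinality into countably many finite kernels before measurability of parametrized integrals is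
used. -/
theorem measurable_sum_map {α : Type*} [MeasurableSpace α] {f : α × User a K → ℝ≥0}
    (hf : Measurable f) :
    Measurable fun q : α × Config a K => ((q.2.map fun z => f (q.1, z)).sum : ℝ≥0) := by
  classical
  let κ : Kernel (α × Config a K) (User a K) :=
    ⟨fun q => q.2.toMeasure, (comap_measurable Config.toMeasure).comp measurable_snd⟩
  have hcard : ∀ n : ℕ, MeasurableSet {q : α × Config a K | q.2.card = n} := by
    intro n
    have h1 : Measurable fun q : α × Config a K => q.2.toMeasure univ :=
      measurable_config_iff.1 measurable_snd univ MeasurableSet.univ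
    have h2 : {q : α × Config a K | q.2.card = n} =
        (fun q : α × Config a K => q.2.toMeasure univ) ⁻¹' {(n : ℝ≥0∞)} := by
      ext q
      simp [Config.toMeasure_univ]
    rw [h2]
    exact h1 (measurableSet_singleton _)
  have hκ : IsSFiniteKernel κ := by
    refine ⟨⟨fun n => Kernel.piecewise (hcard n) κ 0, fun n => ⟨⟨n, ENNReal.natCast_lt_top n,
      fun q => ?_⟩⟩, ?_⟩⟩
    · rw [Kernel.piecewise_apply]
      split_ifs with h
      · exact (Config.toMeasure_univ q.2).trans_le (by rw [show q.2.card = n from h])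
      · simp
    · refine Kernel.ext fun q => Measure.ext fun s hs => ?_
      rw [Kernel.sum_apply' _ _ hs, tsum_eq_single q.2.card]
      · have hq : q ∈ {q' : α × Config a K | q'.2.card = q.2.card} := rfl
        rw [Kernel.piecewise_apply, if_pos hq]
      · intro n hn
        have hq : q ∉ {q : α × Config a K | q.2.card = n} := fun h => hn h.symm
        rw [Kernel.piecewise_apply, if_neg hq]
        rfl
  have hm : Measurable fun p : (α × Config a K) × User a K => (f (p.1.1, p.2) : ℝ≥0∞) := by
    fun_prop
  have h := hm.lintegral_kernel_prod_right' (κ := κ)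
  have heq : (fun q : α × Config a K => ∫⁻ z, (f (q.1, z) : ℝ≥0∞) ∂κ q) =
      fun q => (((q.2.map fun z => f (q.1, z)).sum : ℝ≥0) : ℝ≥0∞) := by
    funext q
    refine (Config.lintegral_toMeasure q.2 (by fun_prop)).trans ?_
    have := map_multiset_sum ENNReal.ofNNRealHom (q.2.map fun z => f (q.1, z))
    rw [Multiset.map_map] at this
    exact this.symm
  rw [heq] at h
  exact measurable_coe_nnreal_ennreal_iff.1 h

theorem measurable_torusDist :
    Measurable fun q : Torus a × Torus a => torusDist q.1 q.2 := by
  unfold torusDist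
  exact Continuous.measurable (by fun_prop)

/-- Membership means that the sum of the indicators of `q.1 = z` over `z` in `q.2` is nonzero, and
the diagonal is measurable coordinate by coordinate. -/
theorem measurableSet_mem_config [Fact (0 < a)] :
    MeasurableSet {q : User a K × Config a K | q.1 ∈ q.2} := by
  classical
  have hdiag : MeasurableSet {q : User a K × User a K | q.1 = q.2} := by
    have h1 : {q : User a K × User a K | q.1 = q.2} = {q | q.1.1.1 = q.2.1.1} ∩
        ({q | q.1.1.2 = q.2.1.2} ∩ {q | q.1.2 = q.2.2}) := by
      ext q
      simp [Prod.ext_iff, and_assoc]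
    rw [h1]
    exact (measurableSet_eq_fun (by fun_prop) (by fun_prop)).inter
      ((measurableSet_eq_fun (by fun_prop) (by fun_prop)).inter
        (measurableSet_eq_fun (by fun_prop) (by fun_prop)))
  have h2 := measurable_sum_map (f := fun q : User a K × User a K => if q.1 = q.2 then 1 else 0)
    (Measurable.ite hdiag measurable_const measurable_const)
  have h3 : {q : User a K × Config a K | q.1 ∈ q.2} =
      ((fun q : User a K × Config a K =>
        ((q.2.map fun z => if q.1 = z then (1 : ℝ≥0) else 0).sum : ℝ≥0)) ⁻¹' {0})ᶜ := by
    ext q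
    rw [mem_compl_iff, mem_preimage, mem_singleton_iff, Multiset.sum_eq_zero_iff]
    refine ⟨fun h h0 => ?_, fun h => ?_⟩
    · exact one_ne_zero (h0 1 (Multiset.mem_map.2 ⟨q.1, h, if_pos rfl⟩))
    · by_contra hq
      refine h fun x hx => ?_
      obtain ⟨z, hz, rfl⟩ := Multiset.mem_map.1 hx
      exact if_neg fun hz' : q.1 = z => hq (show q.1 ∈ q.2 from hz' ▸ hz)
  rw [h3]
  exact (h2 (measurableSet_singleton 0)).compl

theorem measurable_gain {ell : ℝ≥0 → ℝ≥0} (hell : Measurable ell) :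
    Measurable fun q : User a K × User a K =>
      ((q.1.bands ∩ q.2.bands).card : ℝ≥0) * ell (torusDist q.1.rx q.2.tx) := by
  have hcap : Measurable fun q : Cls K × Cls K => ((q.1.1 ∩ q.2.1).card : ℝ≥0) :=
    measurable_of_countable _
  have h1 : Measurable fun q : User a K × User a K => (q.1.2, q.2.2) := by fun_prop
  have h2 : Measurable fun q : User a K × User a K => (q.1.1.1, q.2.1.2) := by fun_prop
  have h3 := hcap.comp h1
  have h4 := hell.comp ((measurable_torusDist (a := a)).comp h2)
  exact h3.mul h4

-- Trades the erasure of `w` for a full sum and a membership test, both of which are measurable.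
open Classical in
theorem interference_eq_sub (ell : ℝ≥0 → ℝ≥0) (w : User a K) (Ψ : Config a K) :
    interference ell w Ψ =
      (Ψ.map fun z => ((w.bands ∩ z.bands).card : ℝ≥0) * ell (torusDist w.rx z.tx)).sum -
      if w ∈ Ψ then ((w.bands ∩ w.bands).card : ℝ≥0) * ell (torusDist w.rx w.tx) else 0 := by
  rw [interference]
  split_ifs with h
  · conv_rhs => rw [← Multiset.cons_erase h, Multiset.map_cons, Multiset.sum_cons]
    rw [add_tsub_cancel_left]
  · rw [Multiset.erase_of_notMem h, tsub_zero]

theorem measurable_interference [Fact (0 < a)] {ell : ℝ≥0 → ℝ≥0} (hell : Measurable ell) :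
    Measurable fun q : User a K × Config a K => interference ell q.1 q.2 := by
  classical
  have hg := measurable_gain (a := a) (K := K) hell
  have hdiag : Measurable fun q : User a K × Config a K => (q.1, q.1) := by fun_prop
  simp only [interference_eq_sub]
  have h1 := measurable_sum_map hg
  have h2 := hg.comp hdiag
  exact h1.sub (Measurable.ite measurableSet_mem_config h2 measurable_const)

theorem measurable_pathLossRate [Fact (0 < a)] {ell : ℝ≥0 → ℝ≥0} (hell : Antitone ell)
    (r N0 : ℝ≥0) : Measurable (Function.uncurry (pathLossRate (a := a) (K := K) ell r N0)) := by
  have hcard : Measurable fun C : Cls K => (C.1.card : ℝ≥0) := measurable_of_countable _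
  have hcls : Measurable fun q : User a K × Config a K => q.1.2 := by fun_prop
  have h1 := hcard.comp hcls
  have h2 := measurable_interference (a := a) (K := K) hell.measurable
  exact (h1.mul measurable_const).div (measurable_const.add h2)

end PathLoss

end SBD

end

theorem mainTheorem4 {a : ℝ} [Fact (0 < a)] {K : ℕ} (r : ℝ≥0) (p : PMF (SBD.Cls K))
    (Φ₀ Φ₀' : SBD.Config a K) (lam lam' : ℝ) (L L' : SBD.Cls K → ℝ)
    (hlam : 0 < lam) (hL : ∀ C, 0 < L C)
    (h_i : lam ≤ lam') (h_ii : ∀ C, L C ≤ L' C) (h_iv : Φ₀ ≤ Φ₀') :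
    (∀ R R' : SBD.Rate a K,
      Measurable (Function.uncurry R) → Measurable (Function.uncurry R') →
      (∀ Ψ Ψ' : SBD.Config a K, Ψ ≤ Ψ' → ∀ w ∈ Ψ, R' w Ψ' ≤ R w Ψ) →
      SBD.Dominates.{u, v} r p ⟨Φ₀', lam', L', R'⟩ ⟨Φ₀, lam, L, R⟩) ∧
    (∀ (ell : ℝ≥0 → ℝ≥0) (N0 : ℝ≥0), Antitone ell → ell 0 = 1 → 0 < N0 →
      SBD.Dominates.{u, v} r p ⟨Φ₀', lam', L', SBD.pathLossRate ell r N0⟩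
        ⟨Φ₀, lam, L, SBD.pathLossRate ell r N0⟩) :=
  ⟨fun _ _ hRm hRm' hR => SBD.dominates_of_rate_le hlam h_i hL h_ii h_iv hRm hRm' hR,
    fun _ _ hell _ hN => SBD.dominates_of_rate_le hlam h_i hL h_ii h_iv
      (SBD.measurable_pathLossRate hell _ _) (SBD.measurable_pathLossRate hell _ _)
      fun _ _ h w _ => SBD.pathLossRate_le _ _ hN w h⟩
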